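/- Let $\mathbb T=\mathbb R/2\pi\mathbb Z$, with normalized Lebesgue measure $\mu$. Functions on $\mathbb T$ are complex-valued, $2\pi$-periodic, finite and defined at every point. Let $X=X(\mathbb T)$ be a Banach function lattice with respect to $\mu$, that is, a complete normed space of measurable functions (the norm does not distinguish functions that agree almost everywhere, but functions in $X$ are considered pointwise) such that 1) if $f$ is measurable, $g\in X$ and $|f|\le|g|$ a.e., then $f\in X$ and $\|f\|_X\le\|g\|_X$; 2) if $f_n\in X$, $\sup_n\|f_n\|_X<\infty$ and $0\le f_n\uparrow f$, then $f\in X$ and $\|f_n\|_X\to\|f\|_X$; 3) if $E\subset\mathbb T$ is measurable, then $\chi_E\in X$ and there is $c_E>0$ with $\int_E|f|\,d\mu\le c_E\|f\|_X$ for all $f\in X$. For $h>0$ put $$A_hf(x)=\frac1h\int_{x-h/2}^{x+h/2}f(t)\,dt,\qquad \dot A_hf(x)=A_hf\left(x+\tfrac h2\right),$$ and suppose that $X$ satisfies Assumption A: $A_hf\in X$ for all $f\in X$ and $h>0$, and $\sup_{h>0,\ \|f\|_X\le1}\|A_hf\|_X<\infty$. Let $r,s\ge1$ be integers with $2r\ge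 s$. For every integer $n\ge1$ let $x_{1,n},\dots,x_{m_n,n}$ be points with $x_{m_n+1,n}=2\pi+x_{1,n}$ and $$\frac{\gamma}{n}\le x_{k+1,n}-x_{k,n}\le\frac{\gamma'}{n},\qquad k=1,\dots,m_n,$$ where $\gamma,\gamma'>0$ do not depend on $n$ and $k$. Define the semi-norm $$\|f\|_{X_n}=\Big\|\sum_{k=1}^{m_n}|f(x_{k,n})|\,\chi_{[x_{k,n},x_{k+1,n})}\Big\|_X .$$ Let $G_nf=\sum_{k=1}^{m_n}f(x_{k,n})\varphi_{k,n}$ be sampling operators such that $G_nf\in\mathcal T_n$ for all $f\in X$ and $n\ge1$, where $\mathcal T_n$ is the set of trigonometric polynomials of degree at most $n$. Suppose that there are constants $K_1,K_3>0$ with $(A_1)$ $\ \|G_nf\|_X\le K_1\|f\|_{X_n}$ for all $f\in X$ and $n\ge1$; $(A_3)$ $\ \|T-G_nT\|_X\le K_3n^{-s}\|T^{(s)}\|_X$ for all $T\in\mathcal T_n$ and $n\ge1$. Then the realization $$R_s(f,1/n)_{X_n}:=\|f-G_nf\|_X+\|f-G_nf\|_{X_n}+n^{-s}\|(G_nf)^{(s)}\|_X$$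 is finite for all $f\in X$ and $n\ge1$, and there are constants $c,C>0$, independent of $f$ and $n$, such that for all $f\in X$ and $n\ge1$ $$c\left(\|(I-A_{\gamma/n})^rf\|_{X_n}+\|(I-\dot A_{\gamma/n})^sf\|_X\right)\le R_s(f,1/n)_{X_n}\le C\left(\|(I-A_{\gamma/n})^rf\|_{X_n}+\|(I-\dot A_{\gamma/n})^sf\|_X\right).$$ -/

import Mathlib

open MeasureTheory Filter Topology
open scoped ENNReal NNReal

noncomputable section

/-- A Banach function lattice `X(𝕋)` over the circle `𝕋 = ℝ/2πℤ`.  Functions on `𝕋` are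
`2π`-periodic functions `ℝ → ℂ`, finite and defined at every point; they are not identified when
they agree almost everywhere, although (as for `L_p`) the norm only sees almost everywhere classes.
The norm is extended by `∞` to all functions that do not belong to `X`, so that
`X = {f | norm f < ∞}`. -/
structure PeriodicBanachLattice where
  /-- the norm of `X`, equal to `∞` outside `X` -/
  norm : (ℝ → ℂ) → ℝ≥0∞
  /-- elements of `X` are Lebesgue measurable -/
  aestronglyMeasurable : ∀ f, norm f < ∞ → AEStronglyMeasurable f volume
  /-- elements of `X` are functions on the circle -/
  periodic : ∀ f, norm f < ∞ → Function.Periodic f (2 * Real.pi)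
  norm_add_le : ∀ f g, norm (f + g) ≤ norm f + norm g
  norm_smul : ∀ (c : ℂ) f, norm (c • f) = ‖c‖ₑ * norm f
  /-- `X` is complete -/
  complete : ∀ u : ℕ → ℝ → ℂ, (∀ k, norm (u k) < ∞) →
    (∀ ε : ℝ≥0∞, 0 < ε → ∃ N, ∀ j ≥ N, ∀ k ≥ N, norm (u j - u k) < ε) →
    ∃ f, norm f < ∞ ∧ Tendsto (fun k => norm (u k - f)) atTop (𝓝 0)
  /-- the lattice property -/
  solid : ∀ f g, AEStronglyMeasurable f volume → Function.Periodic f (2 * Real.pi) →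
    norm g < ∞ → (∀ᵐ x, ‖f x‖ ≤ ‖g x‖) → norm f ≤ norm g
  /-- the Fatou property -/
  fatou : ∀ (u : ℕ → ℝ → ℝ) (f : ℝ → ℝ), (∀ k, norm (fun x => (u k x : ℂ)) < ∞) →
    (⨆ k, norm (fun x => (u k x : ℂ))) < ∞ →
    (∀ x, 0 ≤ u 0 x) → (∀ x, Monotone fun k => u k x) →
    (∀ x, Tendsto (fun k => u k x) atTop (𝓝 (f x))) →
    norm (fun x => (f x : ℂ)) < ∞ ∧
      Tendsto (fun k => norm (fun x => (u k x : ℂ))) atTop (𝓝 (norm fun x => (f x : ℂ)))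
  /-- characteristic functions of measurable subsets of the circle belong to `X` -/
  norm_indicator_lt_top : ∀ E : Set ℝ, NullMeasurableSet E volume →
    (∀ x, x + 2 * Real.pi ∈ E ↔ x ∈ E) → norm (E.indicator fun _ => 1) < ∞
  /-- `∫_E |f| dμ ≤ c_E ‖f‖_X`, where `μ` is the normalized Lebesgue measure on the circle -/
  lintegral_le : ∀ E : Set ℝ, NullMeasurableSet E volume →
    (∀ x, x + 2 * Real.pi ∈ E ↔ x ∈ E) → ∃ c : ℝ≥0, 0 < c ∧ ∀ f, norm f < ∞ →
      (ENNReal.ofReal (2 * Real.pi))⁻¹ * ∫⁻ x in E ∩ Set.Ico (-Real.pi) Real.pi, ‖f x‖ₑ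
        ≤ c * norm f

namespace PeriodicBanachLattice

/-- Membership `f ∈ X`. -/
def Mem (X : PeriodicBanachLattice) (f : ℝ → ℂ) : Prop := X.norm f < ∞

end PeriodicBanachLattice

/-- The Steklov average `A_h f(x) = h⁻¹ ∫_{x-h/2}^{x+h/2} f(t) dt`. -/
def steklov (h : ℝ) (f : ℝ → ℂ) (x : ℝ) : ℂ :=
  (h : ℂ)⁻¹ * ∫ t in (x - h / 2)..(x + h / 2), f t

/-- The forward Steklov average `Ȧ_h f(x) = A_h f(x + h/2)`. -/
def steklovDot (h : ℝ) (f : ℝ → ℂ) (x : ℝ) : ℂ := steklov h f (x + h / 2)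

/-- `(I - A)^r f` for an operator `A` on functions. -/
def diffPow (A : (ℝ → ℂ) → ℝ → ℂ) (r : ℕ) (f : ℝ → ℂ) : ℝ → ℂ := (fun g => g - A g)^[r] f

/-- The Steklov averages `A_h`, `h > 0`, are uniformly bounded operators on `X`. -/
def AssumptionA (X : PeriodicBanachLattice) : Prop :=
  ∃ M : ℝ≥0, ∀ h : ℝ, 0 < h → ∀ f, X.Mem f → X.norm (steklov h f) ≤ M * X.norm f

/-- `𝒯_n`: the trigonometric polynomials of degree at most `n`. -/
def trigPoly (n : ℕ) : Set (ℝ → ℂ) :=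
  {T | ∃ c : ℤ → ℂ, ∀ x : ℝ,
    T x = ∑ k ∈ Finset.Icc (-(n : ℤ)) n, c k * Complex.exp (Complex.I * k * x)}

/-- For every `n ≥ 1`, the points `x n 1, …, x n (m n)` of the circle, in cyclic order and with
`x n (m n + 1) = 2π + x n 1`, have gaps between `γ / n` and `γ' / n`. -/
def IsNodeSystem (γ γ' : ℝ) (m : ℕ → ℕ) (x : ℕ → ℕ → ℝ) : Prop :=
  ∀ n : ℕ, 1 ≤ n → x n (m n + 1) = 2 * Real.pi + x n 1 ∧
    ∀ k ∈ Finset.Icc 1 (m n), γ / n ≤ x n (k + 1) - x n k ∧ x n (k + 1) - x n k ≤ γ' / n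

/-- The arc `[a, b)` of the circle, as a `2π`-periodic subset of `ℝ`. -/
def arc (a b : ℝ) : Set ℝ := {y | ∃ j : ℤ, y + j * (2 * Real.pi) ∈ Set.Ico a b}

/-- The discrete semi-norm `‖∑_{k=1}^m |f(x_k)| χ_{[x_k, x_{k+1})}‖_X`. -/
def discreteNorm (X : PeriodicBanachLattice) (m : ℕ) (x : ℕ → ℝ) (f : ℝ → ℂ) : ℝ≥0∞ :=
  X.norm fun y => ∑ k ∈ Finset.Icc 1 m,
    (arc (x k) (x (k + 1))).indicator (fun _ => ((‖f (x k)‖ : ℝ) : ℂ)) y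

/-- The sampling operator `G f = ∑_{k=1}^m f(x_k) φ_k`. -/
def sampling (m : ℕ) (x : ℕ → ℝ) (φ : ℕ → ℝ → ℂ) (f : ℝ → ℂ) (y : ℝ) : ℂ :=
  ∑ k ∈ Finset.Icc 1 m, f (x k) * φ k y

/-- `‖G_n f‖_X ≤ K ‖f‖_{X_n}` for all `f ∈ X` and `n ≥ 1`. -/
def ConditionA1 (X : PeriodicBanachLattice) (m : ℕ → ℕ) (x : ℕ → ℕ → ℝ)
    (φ : ℕ → ℕ → ℝ → ℂ) : Prop :=
  ∃ K : ℝ≥0, 0 < K ∧ ∀ n : ℕ, 1 ≤ n → ∀ f, X.Mem f →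
    X.norm (sampling (m n) (x n) (φ n) f) ≤ K * discreteNorm X (m n) (x n) f

/-- `‖T - G_n T‖_X ≤ K n^{-s} ‖T^{(s)}‖_X` for all `T ∈ 𝒯_n` and `n ≥ 1`. -/
def ConditionA3 (X : PeriodicBanachLattice) (s : ℕ) (m : ℕ → ℕ) (x : ℕ → ℕ → ℝ)
    (φ : ℕ → ℕ → ℝ → ℂ) : Prop :=
  ∃ K : ℝ≥0, 0 < K ∧ ∀ n : ℕ, 1 ≤ n → ∀ T ∈ trigPoly n,
    X.norm (T - sampling (m n) (x n) (φ n) T) ≤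
      K * ENNReal.ofReal ((1 / (n : ℝ)) ^ s) * X.norm (iteratedDeriv s T)

/-- The realization `R_s(f,h) = ‖f - G f‖_X + ‖f - G f‖_{X_n} + h^s ‖(G f)^{(s)}‖_X` attached to
the sampling operator `G` with nodes `x_1, …, x_m`. -/
def realization (X : PeriodicBanachLattice) (s m : ℕ) (x : ℕ → ℝ) (φ : ℕ → ℝ → ℂ)
    (f : ℝ → ℂ) (h : ℝ) : ℝ≥0∞ :=
  X.norm (f - sampling m x φ f) + discreteNorm X m x (f - sampling m x φ f)
    + ENNReal.ofReal (h ^ s) * X.norm (iteratedDeriv s (sampling m x φ f))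

end

/-! The core is a first-order estimate in `X`. Put `h = γ / n`, `g = Ȧ_h f` and `w = f - g`. Then
`g` differs from its own forward average by the forward average of `w`. An approximate fixed point
of forward averaging has contracting oscillation: its oscillation on one window of length `h` is at
most 3/4 of that on the next window, plus local averages of `|w|` (`oscillation_contraction`).
Iterating bounds every increment of `g` by a geometric sum of such averages and a remainder that
tends to 0, since `g` is bounded. Translations need not be bounded on `X`, so every window is
enlarged to one centred at `x`, where Assumption A applies (`Mem.bdd_local`). A kernel of height
`1/h` with decay `h³/t⁴` then satisfies `‖∫ J(t) (f(x+t) - f(x)) dt‖_X ≤ C ‖f - Ȧ_h f‖_X`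
(`Mem.nrm_kernel_integral_le`).

Two kernels are inserted. A Jackson-type kernel of mean 1 gives approximation by polynomials; since
convolution commutes with `Ȧ_h`, the estimate iterates to order `s` (`exists_trigPoly_nrm_sub_le`).
The derivative of a kernel that reproduces `𝒯_n` gives `n^{-s} ‖T^{(s)}‖ ≤ C ‖(I - Ȧ_h)^s T‖`
(`nrm_iteratedDeriv_le`), and with it Bernstein's inequality.

On the discrete side, the semi-norm of a Steklov average is bounded by the norm in `X`. Hence
`‖g‖_{X_n}` and `‖(I - A_h)^r g‖_{X_n}` differ by at most `C ‖g‖_X` (`dnrm_diffPow_compare`). For a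
polynomial, `(I - A_h)^r T` costs `2r ≥ s` derivatives, and Bernstein's inequality absorbs the
excess (`exists_dnrm_diffPow_trigPoly_le`).

The lower estimate compares `f` with the polynomial `G_n f` (`exists_modulus_le`). For the upper
one, let `T` be the Jackson approximant and write `f - G_n f = (f - T) + (T - G_n T) - G_n (f - T)`.
The terms are bounded by Jackson's estimate, by `(A_3)` with the derivative estimate, and by `(A_1)`
with the discrete comparison (`exists_realization_le`). -/

noncomputable section

/-! ### Real-valued norms and majorants in the lattice -/

namespace PeriodicBanachLattice

variable (X : PeriodicBanachLattice)

/-- The norm of `X` as a real number. -/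
def nrm (f : ℝ → ℂ) : ℝ := (X.norm f).toReal

/-- The real function `Φ` belongs to `X` and has norm at most `B`. -/
def Bdd (Φ : ℝ → ℝ) (B : ℝ) : Prop := X.Mem (fun x => (Φ x : ℂ)) ∧ X.nrm (fun x => (Φ x : ℂ)) ≤ B

variable {X}

lemma nrm_nonneg (f : ℝ → ℂ) : 0 ≤ X.nrm f := ENNReal.toReal_nonneg

lemma Mem.norm_eq {f : ℝ → ℂ} (hf : X.Mem f) : X.norm f = ENNReal.ofReal (X.nrm f) :=
  (ENNReal.ofReal_toReal (ne_of_lt hf)).symm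

lemma Mem.smul (c : ℂ) {f : ℝ → ℂ} (hf : X.Mem f) : X.Mem (c • f) := by
  rw [Mem, X.norm_smul]
  exact ENNReal.mul_lt_top enorm_lt_top hf

lemma nrm_smul (c : ℂ) (f : ℝ → ℂ) : X.nrm (c • f) = ‖c‖ * X.nrm f := by
  simp [nrm, X.norm_smul, ENNReal.toReal_mul]

lemma Mem.add {f g : ℝ → ℂ} (hf : X.Mem f) (hg : X.Mem g) : X.Mem (f + g) :=
  (X.norm_add_le f g).trans_lt (ENNReal.add_lt_top.2 ⟨hf, hg⟩)

lemma nrm_add_le {f g : ℝ → ℂ} (hf : X.Mem f) (hg : X.Mem g) :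
    X.nrm (f + g) ≤ X.nrm f + X.nrm g := by
  rw [nrm, nrm, nrm, ← ENNReal.toReal_add hf.ne hg.ne]
  exact ENNReal.toReal_mono (ENNReal.add_ne_top.2 ⟨hf.ne, hg.ne⟩) (X.norm_add_le f g)

lemma Mem.neg {f : ℝ → ℂ} (hf : X.Mem f) : X.Mem (-f) := by
  simpa using hf.smul (-1)

lemma nrm_neg (f : ℝ → ℂ) : X.nrm (-f) = X.nrm f := by
  simpa using nrm_smul (X := X) (-1) f

lemma Mem.sub {f g : ℝ → ℂ} (hf : X.Mem f) (hg : X.Mem g) : X.Mem (f - g) := by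
  simpa [sub_eq_add_neg] using hf.add hg.neg

lemma nrm_sub_le {f g : ℝ → ℂ} (hf : X.Mem f) (hg : X.Mem g) :
    X.nrm (f - g) ≤ X.nrm f + X.nrm g := by
  simpa [sub_eq_add_neg, nrm_neg] using nrm_add_le hf hg.neg

lemma nrm_sub_comm (f g : ℝ → ℂ) : X.nrm (f - g) = X.nrm (g - f) := by
  rw [← nrm_neg, neg_sub]

lemma mem_of_norm_le {f g : ℝ → ℂ} (hm : AEStronglyMeasurable f volume)
    (hp : Function.Periodic f (2 * Real.pi)) (hg : X.Mem g) (h : ∀ x, ‖f x‖ ≤ ‖g x‖) :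
    X.Mem f ∧ X.nrm f ≤ X.nrm g := by
  have := X.solid f g hm hp hg (Eventually.of_forall h)
  exact ⟨this.trans_lt hg, ENNReal.toReal_mono hg.ne this⟩

lemma Mem.measurable {f : ℝ → ℂ} (hf : X.Mem f) : AEStronglyMeasurable f volume :=
  X.aestronglyMeasurable f hf

lemma Mem.per {f : ℝ → ℂ} (hf : X.Mem f) : Function.Periodic f (2 * Real.pi) :=
  X.periodic f hf

lemma mem_one : X.Mem (fun _ => 1) := by
  have := X.norm_indicator_lt_top Set.univ nullMeasurableSet_univ (by simp)
  simpa [Mem, Set.indicator_univ] using this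

lemma mem_zero : X.Mem 0 := by simpa using (mem_one (X := X)).smul 0

lemma nrm_zero : X.nrm 0 = 0 := by simpa using nrm_smul (X := X) 0 0

lemma mem_of_bounded {f : ℝ → ℂ} (hm : AEStronglyMeasurable f volume)
    (hp : Function.Periodic f (2 * Real.pi)) {B : ℝ} (h : ∀ x, ‖f x‖ ≤ B) : X.Mem f := by
  refine (mem_of_norm_le hm hp ((mem_one (X := X)).smul (B : ℂ)) fun x => ?_).1
  simpa using (h x).trans (le_abs_self B)

lemma Bdd.add {Φ Ψ : ℝ → ℝ} {B B' : ℝ} (h : X.Bdd Φ B) (h' : X.Bdd Ψ B') :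
    X.Bdd (fun x => Φ x + Ψ x) (B + B') := by
  have e : (fun x => ((Φ x + Ψ x : ℝ) : ℂ)) = (fun x => (Φ x : ℂ)) + fun x => (Ψ x : ℂ) := by
    ext x; simp
  rw [Bdd, e]
  exact ⟨h.1.add h'.1, (nrm_add_le h.1 h'.1).trans (add_le_add h.2 h'.2)⟩

lemma Bdd.const_mul {Φ : ℝ → ℝ} {B c : ℝ} (hc : 0 ≤ c) (h : X.Bdd Φ B) :
    X.Bdd (fun x => c * Φ x) (c * B) := by
  have e : (fun x => ((c * Φ x : ℝ) : ℂ)) = (c : ℂ) • fun x => (Φ x : ℂ) := by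
    ext x; simp
  rw [Bdd, e, nrm_smul]
  refine ⟨h.1.smul _, ?_⟩
  simpa [abs_of_nonneg hc] using mul_le_mul_of_nonneg_left h.2 hc

lemma bdd_zero : X.Bdd (fun _ => 0) 0 := by
  have e : (fun _ : ℝ => ((0 : ℝ) : ℂ)) = 0 := by ext; simp
  rw [Bdd, e, nrm_zero]
  exact ⟨mem_zero, le_rfl⟩

lemma Bdd.sum {ι : Type*} (s : Finset ι) {Φ : ι → ℝ → ℝ} {B : ι → ℝ}
    (h : ∀ i ∈ s, X.Bdd (Φ i) (B i)) : X.Bdd (fun x => ∑ i ∈ s, Φ i x) (∑ i ∈ s, B i) := by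
  classical
  induction s using Finset.induction_on with
  | empty => simpa using bdd_zero
  | insert a s ha ih =>
    simp only [Finset.sum_insert ha]
    exact (h a (by simp)).add (ih fun i hi => h i (by simp [hi]))

/-- The lattice property in working form: a majorant is assembled from pieces by `Bdd.add`,
`Bdd.const_mul` and `Bdd.sum`, and one pointwise inequality then yields the norm estimate. -/
lemma Bdd.bound {F : ℝ → ℂ} {Φ : ℝ → ℝ} {B : ℝ} (h : X.Bdd Φ B)
    (hm : AEStronglyMeasurable F volume) (hp : Function.Periodic F (2 * Real.pi))
    (hF : ∀ x, ‖F x‖ ≤ Φ x) : X.Mem F ∧ X.nrm F ≤ B := by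
  have := mem_of_norm_le hm hp h.1 fun x => by
    simpa using (hF x).trans (le_abs_self _)
  exact ⟨this.1, this.2.trans h.2⟩

lemma bdd_const {c : ℝ} (hc : 0 ≤ c) : X.Bdd (fun _ => c) (c * X.nrm fun _ => 1) := by
  have : X.Bdd (fun _ => (1 : ℝ)) (X.nrm fun _ => 1) := by
    simp only [Bdd, Complex.ofReal_one]
    exact ⟨mem_one, le_rfl⟩
  simpa using this.const_mul hc

lemma Mem.bdd_norm {f : ℝ → ℂ} (hf : X.Mem f) : X.Bdd (fun x => ‖f x‖) (X.nrm f) :=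
  mem_of_norm_le (Complex.continuous_ofReal.comp_aestronglyMeasurable hf.measurable.norm)
    (fun x => by simp [hf.per x]) hf fun x => by simp

/-- The embedding of `X` into `L_1`, taken with `E` the whole circle, gives integrability over one
period; periodicity extends it to every interval. -/
lemma Mem.intervalIntegrable {f : ℝ → ℂ} (hf : X.Mem f) (a b : ℝ) :
    IntervalIntegrable f volume a b := by
  obtain ⟨c, -, hc⟩ := X.lintegral_le Set.univ nullMeasurableSet_univ (by simp)
  have h1 := hc f hf
  have h2 : (∫⁻ x in Set.Ico (-Real.pi) Real.pi, ‖f x‖ₑ) < ∞ := by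
    by_contra h
    rw [Set.univ_inter, not_lt_top_iff.1 h, ENNReal.mul_top (by simp [ENNReal.mul_eq_top])] at h1
    exact absurd (h1.trans_lt (ENNReal.mul_lt_top (by simp) hf)) (lt_irrefl _)
  have h3 : IntervalIntegrable f volume (-Real.pi) (-Real.pi + 2 * Real.pi) := by
    rw [show -Real.pi + 2 * Real.pi = Real.pi by ring,
      intervalIntegrable_iff_integrableOn_Ico_of_le (by linarith [Real.pi_pos])]
    exact ⟨hf.measurable.restrict, h2⟩
  exact hf.per.intervalIntegrable Real.two_pi_pos.ne' h3 a b

/-- The local integrals `∫_{x-a}^{x+a} |f|` are controlled in `X`. -/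
lemma Mem.bdd_local {M : ℝ≥0}
    (hM : ∀ h : ℝ, 0 < h → ∀ f, X.Mem f → X.norm (steklov h f) ≤ M * X.norm f)
    {f : ℝ → ℂ} (hf : X.Mem f) {a : ℝ} (ha : 0 < a) :
    X.Bdd (fun x => ∫ t in (x - a)..(x + a), ‖f t‖) (2 * a * (M * X.nrm f)) := by
  obtain ⟨h1, h2⟩ := hf.bdd_norm
  have h3 := hM (2 * a) (by linarith) _ h1
  have h4 : X.Mem (steklov (2 * a) fun x => (‖f x‖ : ℂ)) :=
    h3.trans_lt (ENNReal.mul_lt_top (by simp) h1)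
  -- A local integral over a centred window is a multiple of a Steklov average of `|f|`, which is
  -- what Assumption A bounds.
  have e : (fun x => ((∫ t in (x - a)..(x + a), ‖f t‖ : ℝ) : ℂ))
      = ((2 * a : ℝ) : ℂ) • steklov (2 * a) fun x => (‖f x‖ : ℂ) := by
    ext x
    have : ((2 * a : ℝ) : ℂ) ≠ 0 := by exact_mod_cast (by linarith : (2 * a : ℝ) ≠ 0)
    simp only [Pi.smul_apply, steklov, smul_eq_mul, mul_inv_cancel_left₀ this]
    rw [show 2 * a / 2 = a by ring, intervalIntegral.integral_ofReal]
  rw [Bdd, e, nrm_smul]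
  refine ⟨h4.smul _, ?_⟩
  have h5 : X.nrm (steklov (2 * a) fun x => (‖f x‖ : ℂ)) ≤ M * X.nrm f := by
    refine le_trans ?_ (mul_le_mul_of_nonneg_left h2 M.2)
    have := ENNReal.toReal_mono (ENNReal.mul_ne_top (by simp) h1.ne) h3
    simpa [nrm, ENNReal.toReal_mul] using this
  rw [Complex.norm_of_nonneg (by linarith)]
  exact mul_le_mul_of_nonneg_left h5 (by linarith)

end PeriodicBanachLattice

/-! ### Oscillation of functions close to their forward average -/

/-- One backward half step of the maximum principle for `G y = ∫_y^{y+1} G + e`. -/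
lemma norm_sub_le_of_average_half {G : ℝ → ℂ} (hG : Continuous G) {a ε R : ℝ} (c : ℂ)
    (hR : ∀ p ∈ Set.Icc (a + 1 / 2) (a + 3 / 2), ‖G p - c‖ ≤ R)
    (he : ∀ y ∈ Set.Icc a (a + 1 / 2), ‖G y - ∫ t in y..(y + 1), G t‖ ≤ ε) :
    ∀ y ∈ Set.Icc a (a + 3 / 2), ‖G y - c‖ ≤ R + 2 * ε := by
  have hε : 0 ≤ ε := (norm_nonneg _).trans (he a ⟨le_rfl, by linarith⟩)
  obtain ⟨z, hz, hmax⟩ := (isCompact_Icc (a := a) (b := a + 1 / 2)).exists_isMaxOn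
    ⟨a, le_rfl, by linarith⟩ (f := fun y => ‖G y - c‖) (by fun_prop)
  have hz1 := hz.1
  have hz2 := hz.2
  set S := ‖G z - c‖ with hS
  have hmax' : ∀ y ∈ Set.Icc a (a + 1 / 2), ‖G y - c‖ ≤ S := fun y hy => hmax hy
  -- At the maximum point `z` the average over `[z, z+1]` sees the unknown part `[z, a+1/2]` with
  -- weight `λ ≤ 1/2` and the known part with weight `1 - λ`. So `S ≤ ε + λ S + (1 - λ) R`, hence `S
  -- - R ≤ 2 ε`.
  have hSR : S ≤ R + 2 * ε := by
    by_contra! hlt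
    have h1 : ‖∫ t in z..(a + 1 / 2), (G t - c)‖ ≤ S * |a + 1 / 2 - z| :=
      intervalIntegral.norm_integral_le_of_norm_le_const fun t ht => by
        rw [Set.uIoc_of_le hz2] at ht
        exact hmax' t ⟨by linarith [ht.1], ht.2⟩
    have h2 : ‖∫ t in (a + 1 / 2)..(z + 1), (G t - c)‖ ≤ R * |z + 1 - (a + 1 / 2)| :=
      intervalIntegral.norm_integral_le_of_norm_le_const fun t ht => by
        rw [Set.uIoc_of_le (by linarith)] at ht
        exact hR t ⟨ht.1.le, by linarith [ht.2]⟩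
    rw [abs_of_nonneg (by linarith)] at h1 h2
    have hi : ∀ p q : ℝ, IntervalIntegrable (fun t => G t - c) volume p q :=
      fun p q => (hG.sub continuous_const).intervalIntegrable p q
    have h3 : G z - c = (G z - ∫ t in z..(z + 1), G t)
        + ((∫ t in z..(a + 1 / 2), (G t - c)) + ∫ t in (a + 1 / 2)..(z + 1), (G t - c)) := by
      rw [intervalIntegral.integral_add_adjacent_intervals (hi _ _) (hi _ _),
        intervalIntegral.integral_sub (hG.intervalIntegrable _ _)
          (continuous_const.intervalIntegrable _ _)]
      simp
    have h4 : S ≤ ε + (S * (a + 1 / 2 - z) + R * (z + 1 - (a + 1 / 2))) := by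
      have h5 := norm_add_le_of_le (he z hz) (norm_add_le_of_le h1 h2)
      rwa [← h3] at h5
    nlinarith
  intro y hy
  rcases le_total y (a + 1 / 2) with h | h
  · exact (hmax' y ⟨hy.1, h⟩).trans hSR
  · exact (hR y ⟨h, hy.2⟩).trans (by linarith)

/-- The backward maximum principle for `G y = ∫_y^{y+1} G + e`. -/
lemma norm_sub_le_of_average {G : ℝ → ℂ} (hG : Continuous G) {ε R : ℝ} (c : ℂ)
    (hR : ∀ p ∈ Set.Icc (1 : ℝ) 2, ‖G p - c‖ ≤ R)
    (he : ∀ y ∈ Set.Icc (0 : ℝ) 1, ‖G y - ∫ t in y..(y + 1), G t‖ ≤ ε) :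
    ∀ y ∈ Set.Icc (0 : ℝ) 2, ‖G y - c‖ ≤ R + 4 * ε := by
  have hε : 0 ≤ ε := (norm_nonneg _).trans (he 0 (by norm_num))
  -- Two half steps, each costing `2 ε`; a single full step would leave no fixed weight on the known
  -- part.
  have h1 := norm_sub_le_of_average_half hG (a := 1 / 2) c
    (fun p hp => hR p ⟨by linarith [hp.1], by linarith [hp.2]⟩)
    (fun y hy => he y ⟨by linarith [hy.1], by linarith [hy.2]⟩)
  have h2 := norm_sub_le_of_average_half hG (a := 0) c
    (fun p hp => h1 p ⟨by linarith [hp.1], by linarith [hp.2]⟩)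
    (fun y hy => he y ⟨by linarith [hy.1], by linarith [hy.2]⟩)
  intro y hy
  rcases le_total y 1 with h | h
  · exact (h2 y ⟨hy.1, by linarith⟩).trans (by linarith)
  · exact (hR y ⟨h, hy.2⟩).trans (by linarith)

/-- Contraction of the oscillation for `G y = ∫_y^{y+1} G + e`. -/
lemma oscillation_contraction {G : ℝ → ℂ} (hG : Continuous G) {ε R : ℝ}
    (hR : ∀ p ∈ Set.Icc (1 : ℝ) 2, ∀ q ∈ Set.Icc (1 : ℝ) 2, ‖G p - G q‖ ≤ R)
    (he : ∀ y ∈ Set.Icc (0 : ℝ) 1, ‖G y - ∫ t in y..(y + 1), G t‖ ≤ ε) :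
    ∀ y ∈ Set.Icc (0 : ℝ) 1, ∀ z ∈ Set.Icc (0 : ℝ) 1, ‖G y - G z‖ ≤ 3 / 4 * R + 10 * ε := by
  have hε : 0 ≤ ε := (norm_nonneg _).trans (he 0 (by norm_num))
  have hi : ∀ p q : ℝ, IntervalIntegrable G volume p q := fun p q => hG.intervalIntegrable p q
  -- The maximum principle is used once in each variable: first with the centre `G p`, `p ∈ [1, 2]`,
  -- then with the centre `G z` for any `z ∈ [0, 2]`.
  have hosc : ∀ y ∈ Set.Icc (0 : ℝ) 2, ∀ z ∈ Set.Icc (0 : ℝ) 2, ‖G y - G z‖ ≤ R + 8 * ε := by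
    have h1 : ∀ y ∈ Set.Icc (0 : ℝ) 2, ∀ p ∈ Set.Icc (1 : ℝ) 2, ‖G y - G p‖ ≤ R + 4 * ε :=
      fun y hy p hp => norm_sub_le_of_average hG (G p) (fun q hq => hR q hq p hp) he y hy
    intro y hy z hz
    refine (norm_sub_le_of_average hG (G z) (fun q hq => ?_) he y hy).trans
      (by linarith : R + 4 * ε + 4 * ε ≤ _)
    rw [norm_sub_rev]
    exact h1 z hz q hq
  set Ω := R + 8 * ε with hΩ
  have hΩ0 : 0 ≤ Ω := (norm_nonneg _).trans (hosc 0 (by norm_num) 0 (by norm_num))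
  -- The averages over `[y, y+1]` and `[z, z+1]` share their overlap, so they differ by the integral
  -- of `G t - G (t+1)` over `[y, z]`, whose length is at most 1/2.
  have hclose : ∀ y z : ℝ, 0 ≤ y → z ≤ 1 → y ≤ z → z ≤ y + 1 / 2 →
      ‖G y - G z‖ ≤ Ω / 2 + 2 * ε := by
    intro y z hy hz hyz hzy
    have h1 : ‖∫ t in y..z, (G t - G (t + 1))‖ ≤ Ω * |z - y| :=
      intervalIntegral.norm_integral_le_of_norm_le_const fun t ht => by
        rw [Set.uIoc_of_le hyz] at ht
        exact hosc _ ⟨by linarith [ht.1], by linarith [ht.2]⟩ _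
          ⟨by linarith [ht.1], by linarith [ht.2]⟩
    rw [abs_of_nonneg (by linarith)] at h1
    have h2 : (∫ t in y..z, (G t - G (t + 1)))
        = (∫ t in y..(y + 1), G t) - ∫ t in z..(z + 1), G t := by
      have hG1 : Continuous fun t => G (t + 1) := by fun_prop
      rw [intervalIntegral.integral_sub (hi _ _) (hG1.intervalIntegrable _ _),
        intervalIntegral.integral_comp_add_right G 1]
      have e1 := intervalIntegral.integral_add_adjacent_intervals (hi y z) (hi z (y + 1))
      have e2 := intervalIntegral.integral_add_adjacent_intervals (hi z (y + 1)) (hi (y + 1) (z + 1))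
      linear_combination e1 - e2
    have h3 : G y - G z = (G y - ∫ t in y..(y + 1), G t)
        + (∫ t in y..z, (G t - G (t + 1))) - (G z - ∫ t in z..(z + 1), G t) := by
      rw [h2]; ring
    rw [h3]
    calc _ ≤ ε + Ω * (z - y) + ε :=
          (norm_sub_le _ _).trans (add_le_add ((norm_add_le _ _).trans
            (add_le_add (he y ⟨hy, by linarith⟩) h1)) (he z ⟨by linarith, hz⟩))
      _ ≤ _ := by nlinarith
  have hle : ∀ y ∈ Set.Icc (0 : ℝ) 1, ∀ z ∈ Set.Icc (0 : ℝ) 1, y ≤ z →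
      ‖G y - G z‖ ≤ 3 / 4 * R + 10 * ε := by
    intro y hy z hz hyz
    obtain ⟨hy0, hy1⟩ := hy
    obtain ⟨hz0, hz1⟩ := hz
    rcases le_total z (y + 1 / 2) with h | h
    · refine (hclose y z hy0 hz1 hyz h).trans ?_
      have : 0 ≤ R := (norm_nonneg _).trans (hR 1 (by norm_num) 1 (by norm_num))
      rw [hΩ]; linarith
    -- For distant points, compare `G z` with the values averaged over `[y, y+1]`. The half `[z -
    -- 1/2, z]` is close to `z` and contributes about `Ω/4`, the other half at most `Ω/2`; this is
    -- the factor 3/4.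
    · have b1 : ‖∫ t in y..(z - 1 / 2), (G t - G z)‖ ≤ Ω * |z - 1 / 2 - y| :=
        intervalIntegral.norm_integral_le_of_norm_le_const fun t ht => by
          rw [Set.uIoc_of_le (by linarith)] at ht
          exact hosc _ ⟨by linarith [ht.1], by linarith [ht.2]⟩ _ ⟨by linarith, by linarith⟩
      have b2 : ‖∫ t in (z - 1 / 2)..z, (G t - G z)‖ ≤ (Ω / 2 + 2 * ε) * |z - (z - 1 / 2)| :=
        intervalIntegral.norm_integral_le_of_norm_le_const fun t ht => by
          rw [Set.uIoc_of_le (by linarith)] at ht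
          exact hclose _ _ (by linarith [ht.1]) hz1 ht.2 (by linarith [ht.1])
      have b3 : ‖∫ t in z..(y + 1), (G t - G z)‖ ≤ Ω * |y + 1 - z| :=
        intervalIntegral.norm_integral_le_of_norm_le_const fun t ht => by
          rw [Set.uIoc_of_le (by linarith)] at ht
          exact hosc _ ⟨by linarith [ht.1], by linarith [ht.2]⟩ _ ⟨by linarith, by linarith⟩
      rw [abs_of_nonneg (by linarith)] at b1 b2 b3
      have hj : ∀ p q : ℝ, IntervalIntegrable (fun t => G t - G z) volume p q :=
        fun p q => (hG.sub continuous_const).intervalIntegrable p q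
      have h3 : G y - G z = (G y - ∫ t in y..(y + 1), G t)
          + ((∫ t in y..(z - 1 / 2), (G t - G z)) + (∫ t in (z - 1 / 2)..z, (G t - G z))
            + ∫ t in z..(y + 1), (G t - G z)) := by
        rw [intervalIntegral.integral_add_adjacent_intervals (hj _ _) (hj _ _),
          intervalIntegral.integral_add_adjacent_intervals (hj _ _) (hj _ _),
          intervalIntegral.integral_sub (hi _ _) (continuous_const.intervalIntegrable _ _)]
        simp
      rw [h3]
      calc _ ≤ ε + (Ω * (z - 1 / 2 - y) + (Ω / 2 + 2 * ε) * (z - (z - 1 / 2))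
            + Ω * (y + 1 - z)) :=
            (norm_add_le _ _).trans (add_le_add (he y ⟨hy0, hy1⟩) ((norm_add_le _ _).trans
              (add_le_add ((norm_add_le _ _).trans (add_le_add b1 b2)) b3)))
        _ ≤ _ := by rw [hΩ]; linarith
  intro y hy z hz
  rcases le_total y z with h | h
  · exact hle y hy z hz h
  · rw [norm_sub_rev]; exact hle z hz y hy h

lemma steklovDot_eq (h : ℝ) (f : ℝ → ℂ) (x : ℝ) :
    steklovDot h f x = (h : ℂ)⁻¹ * ∫ t in x..(x + h), f t := by
  simp only [steklovDot, steklov]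
  congr 2 <;> ring

lemma continuous_integral_window {f : ℝ → ℂ} (hf : ∀ a b, IntervalIntegrable f volume a b)
    (a b : ℝ) : Continuous fun x => ∫ t in (x + a)..(x + b), f t := by
  have hF := intervalIntegral.continuous_primitive hf 0
  have e : (fun x => ∫ t in (x + a)..(x + b), f t)
      = fun x => (∫ t in (0 : ℝ)..(x + b), f t) - ∫ t in (0 : ℝ)..(x + a), f t := by
    ext x
    exact (intervalIntegral.integral_interval_sub_left (hf _ _) (hf _ _)).symm
  rw [e]
  exact (hF.comp (by fun_prop)).sub (hF.comp (by fun_prop))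

lemma continuous_steklovDot {f : ℝ → ℂ} (hf : ∀ a b, IntervalIntegrable f volume a b) (h : ℝ) :
    Continuous (steklovDot h f) := by
  have e : steklovDot h f = fun x => (h : ℂ)⁻¹ * ∫ t in (x + 0)..(x + h), f t := by
    ext x; rw [steklovDot_eq, add_zero]
  rw [e]
  exact continuous_const.mul (continuous_integral_window hf 0 h)

lemma norm_integral_le_of_subset {f : ℝ → ℂ} (hf : ∀ a b, IntervalIntegrable f volume a b)
    {a b c d : ℝ} (hca : c ≤ a) (hab : a ≤ b) (hbd : b ≤ d) :
    ‖∫ t in a..b, f t‖ ≤ ∫ t in c..d, ‖f t‖ :=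
  (intervalIntegral.norm_integral_le_integral_norm hab).trans
    (intervalIntegral.integral_mono_interval hca hab hbd
      (Eventually.of_forall fun _ => norm_nonneg _) (hf c d).norm)

lemma integral_norm_mono {f : ℝ → ℂ} (hf : ∀ a b, IntervalIntegrable f volume a b)
    {a b c d : ℝ} (hca : c ≤ a) (hab : a ≤ b) (hbd : b ≤ d) :
    ∫ t in a..b, ‖f t‖ ≤ ∫ t in c..d, ‖f t‖ :=
  intervalIntegral.integral_mono_interval hca hab hbd
    (Eventually.of_forall fun _ => norm_nonneg _) (hf c d).norm

section Oscillation

variable {f : ℝ → ℂ} (hf : ∀ a b, IntervalIntegrable f volume a b) {h : ℝ} (hh : 0 < h)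
include hf hh

/-- `oscillation_contraction` after the rescaling `τ ↦ b + h τ`, with the error `ε` given by the
local average of `|f - Ȧ_h f|`. -/
lemma steklovDot_oscillation_step {b R : ℝ}
    (hR : ∀ p ∈ Set.Icc (b + h) (b + 2 * h), ∀ q ∈ Set.Icc (b + h) (b + 2 * h),
      ‖steklovDot h f p - steklovDot h f q‖ ≤ R) :
    ∀ p ∈ Set.Icc b (b + h), ∀ q ∈ Set.Icc b (b + h),
      ‖steklovDot h f p - steklovDot h f q‖
        ≤ 3 / 4 * R + 10 * (h⁻¹ * ∫ t in b..(b + 2 * h), ‖(f - steklovDot h f) t‖) := by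
  set g := steklovDot h f with hg
  have hgc : Continuous g := continuous_steklovDot hf h
  have hw : ∀ a b, IntervalIntegrable (f - g) volume a b :=
    fun a b => (hf a b).sub (hgc.intervalIntegrable a b)
  have key := oscillation_contraction (G := fun τ => g (b + h * τ)) (by fun_prop)
    (ε := h⁻¹ * ∫ t in b..(b + 2 * h), ‖(f - g) t‖) (R := R)
    (fun p hp q hq => hR _ ⟨by nlinarith [hp.1], by nlinarith [hp.2]⟩ _
      ⟨by nlinarith [hq.1], by nlinarith [hq.2]⟩)
    (fun y hy => by
      have e1 : (∫ t in y..(y + 1), g (b + h * t))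
          = (h : ℂ)⁻¹ * ∫ t in (b + h * y)..(b + h * y + h), g t := by
        rw [intervalIntegral.integral_comp_add_mul g hh.ne' b]
        simp only [Complex.real_smul, Complex.ofReal_inv]
        congr 2; ring
      -- `g` is the forward average of `f`, so its defect from its own forward average is the
      -- forward average of `f - g`.
      have e2 : g (b + h * y) - ∫ t in y..(y + 1), g (b + h * t)
          = (h : ℂ)⁻¹ * ∫ t in (b + h * y)..(b + h * y + h), (f - g) t := by
        rw [e1]
        conv_lhs => rw [hg, steklovDot_eq]
        simp only [Pi.sub_apply]
        rw [intervalIntegral.integral_sub (hf _ _) (hgc.intervalIntegrable _ _), mul_sub]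
      rw [e2, norm_mul, norm_inv, Complex.norm_of_nonneg hh.le]
      exact mul_le_mul_of_nonneg_left (norm_integral_le_of_subset hw (by nlinarith [hy.1])
        (by linarith) (by nlinarith [hy.2])) (inv_nonneg.2 hh.le))
  intro p hp q hq
  have e : ∀ p, b + h * ((p - b) / h) = p := fun p => by field_simp; ring
  have hmem : ∀ p ∈ Set.Icc b (b + h), (p - b) / h ∈ Set.Icc (0 : ℝ) 1 := fun p hp =>
    ⟨div_nonneg (by linarith [hp.1]) hh.le, (div_le_one hh).2 (by linarith [hp.2])⟩
  have := key _ (hmem p hp) _ (hmem q hq)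
  simpa only [e] using this

lemma steklovDot_oscillation {Ω : ℝ}
    (hΩ : ∀ p q, ‖steklovDot h f p - steklovDot h f q‖ ≤ Ω) (K : ℕ) :
    ∀ b : ℝ, ∀ p ∈ Set.Icc b (b + h), ∀ q ∈ Set.Icc b (b + h),
      ‖steklovDot h f p - steklovDot h f q‖ ≤ (3 / 4) ^ K * Ω
        + 10 * ∑ k ∈ Finset.range K, (3 / 4) ^ k *
          (h⁻¹ * ∫ t in (b + k * h)..(b + k * h + 2 * h), ‖(f - steklovDot h f) t‖) := by
  induction K with
  | zero => intro b p _ q _; simpa using hΩ p q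
  | succ K ih =>
    intro b p hp q hq
    have h1 := steklovDot_oscillation_step hf hh (b := b) (fun p hp q hq => ih (b + h) p
      ⟨hp.1, by linarith [hp.2]⟩ q ⟨hq.1, by linarith [hq.2]⟩) p hp q hq
    refine h1.trans (le_of_eq ?_)
    have e : ∑ k ∈ Finset.range K, (3 / 4 : ℝ) ^ (k + 1) * (h⁻¹ *
          ∫ t in (b + (k + 1 : ℕ) * h)..(b + (k + 1 : ℕ) * h + 2 * h), ‖(f - steklovDot h f) t‖)
        = 3 / 4 * ∑ k ∈ Finset.range K, (3 / 4 : ℝ) ^ k * (h⁻¹ *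
          ∫ t in (b + h + k * h)..(b + h + k * h + 2 * h), ‖(f - steklovDot h f) t‖) := by
      rw [Finset.mul_sum]
      refine Finset.sum_congr rfl fun k _ => ?_
      rw [show b + h + k * h = b + (k + 1 : ℕ) * h by push_cast; ring]
      ring
    rw [Finset.sum_range_succ', e]
    simp only [CharP.cast_eq_zero, zero_mul, add_zero, pow_zero, one_mul]
    ring

/-- At most `L` consecutive windows of length `h` join `x` to `x + t`. The integrals that control
them are enlarged to windows centred at `x`, the only ones bounded in `X` by Assumption A. -/
lemma norm_steklovDot_sub_le {Ω : ℝ}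
    (hΩ : ∀ p q, ‖steklovDot h f p - steklovDot h f q‖ ≤ Ω) (K L : ℕ) (x t : ℝ)
    (ht : |t| ≤ L * h) :
    ‖steklovDot h f (x + t) - steklovDot h f x‖ ≤ L * ((3 / 4) ^ K * Ω
        + 10 * ∑ k ∈ Finset.range K, (3 / 4) ^ k *
          (h⁻¹ * ∫ t in (x - (L + k + 2) * h)..(x + (L + k + 2) * h),
            ‖(f - steklovDot h f) t‖)) := by
  set g := steklovDot h f with hg
  have hgc : Continuous g := continuous_steklovDot hf h
  have hw : ∀ a b, IntervalIntegrable (f - g) volume a b :=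
    fun a b => (hf a b).sub (hgc.intervalIntegrable a b)
  have hΩ0 : 0 ≤ Ω := (norm_nonneg _).trans (hΩ 0 0)
  set B := (3 / 4) ^ K * Ω + 10 * ∑ k ∈ Finset.range K, (3 / 4) ^ k *
    (h⁻¹ * ∫ t in (x - (L + k + 2) * h)..(x + (L + k + 2) * h), ‖(f - g) t‖) with hB
  have hB0 : 0 ≤ B := by
    refine add_nonneg (by positivity) (mul_nonneg (by norm_num) (Finset.sum_nonneg fun k _ => ?_))
    refine mul_nonneg (by positivity) (mul_nonneg (by positivity) ?_)
    refine intervalIntegral.integral_nonneg ?_ fun _ _ => norm_nonneg _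
    have : 0 ≤ (L + k + 2) * h := by positivity
    linarith
  have hwin : ∀ b, x - L * h ≤ b → b ≤ x + L * h → ∀ p ∈ Set.Icc b (b + h),
      ∀ q ∈ Set.Icc b (b + h), ‖g p - g q‖ ≤ B := by
    intro b hb1 hb2 p hp q hq
    refine (steklovDot_oscillation hf hh hΩ K b p hp q hq).trans ?_
    rw [hB]
    gcongr with k hk
    have hkh : 0 ≤ k * h := by positivity
    exact integral_norm_mono hw (by nlinarith) (by linarith) (by nlinarith)
  have hpos : ∀ i : ℕ, i ≤ L → ∀ t, 0 ≤ t → t ≤ i * h → ‖g (x + t) - g x‖ ≤ i * B := by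
    intro i
    induction i with
    | zero =>
      intro _ t h1 h2
      have : t = 0 := by simp at h2; linarith
      simp [this]
    | succ i ih =>
      intro hi t h1 h2
      push_cast at h2 ⊢
      have hiL : (i : ℝ) * h ≤ L * h := by gcongr; omega
      have hi0 : 0 ≤ (i : ℝ) * h := by positivity
      rcases le_total t (i * h) with h3 | h3
      · exact (ih (by omega) t h1 h3).trans (by linarith)
      · have e : g (x + t) - g x = (g (x + t) - g (x + i * h)) + (g (x + i * h) - g x) := by ring
        rw [e]
        refine (norm_add_le_of_le (hwin (x + i * h) (by linarith) (by linarith) _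
          ⟨by linarith, by linarith⟩ _ ⟨by linarith, by linarith⟩)
          (ih (by omega) _ hi0 le_rfl)).trans (by linarith)
  have hneg : ∀ i : ℕ, i ≤ L → ∀ t, 0 ≤ t → t ≤ i * h → ‖g (x - t) - g x‖ ≤ i * B := by
    intro i
    induction i with
    | zero =>
      intro _ t h1 h2
      have : t = 0 := by simp at h2; linarith
      simp [this]
    | succ i ih =>
      intro hi t h1 h2
      have hiL : ((i + 1 : ℕ) : ℝ) * h ≤ L * h := by gcongr
      push_cast at h2 hiL ⊢
      have hi0 : 0 ≤ (i : ℝ) * h := by positivity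
      rcases le_total t (i * h) with h3 | h3
      · exact (ih (by omega) t h1 h3).trans (by linarith)
      · have e : g (x - t) - g x = (g (x - t) - g (x - i * h)) + (g (x - i * h) - g x) := by ring
        rw [e]
        refine (norm_add_le_of_le (hwin (x - (i + 1) * h) (by linarith) (by linarith) _
          ⟨by linarith, by linarith⟩ _ ⟨by linarith, by linarith⟩)
          (ih (by omega) _ hi0 le_rfl)).trans (by linarith)
  rcases le_total 0 t with h0 | h0
  · exact hpos L le_rfl t h0 ((le_abs_self t).trans ht)
  · have := hneg L le_rfl (-t) (by linarith) ((neg_le_abs t).trans ht)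
    simpa using this

end Oscillation

/-! ### Integrals of increments against decaying kernels -/

lemma periodic_steklov {f : ℝ → ℂ} {T : ℝ} (hf : Function.Periodic f T) (h : ℝ) :
    Function.Periodic (steklov h f) T := by
  intro x
  simp only [steklov]
  rw [show x + T - h / 2 = (x - h / 2) + T by ring, show x + T + h / 2 = (x + h / 2) + T by ring,
    ← intervalIntegral.integral_comp_add_right f T]
  simp [hf _]

lemma periodic_steklovDot {f : ℝ → ℂ} {T : ℝ} (hf : Function.Periodic f T) (h : ℝ) :
    Function.Periodic (steklovDot h f) T := by
  intro x
  simp only [steklovDot]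
  rw [add_right_comm, periodic_steklov hf h]

lemma Function.Periodic.exists_norm_le {g : ℝ → ℂ} (hg : Continuous g) {T : ℝ} (hT : 0 < T)
    (hp : Function.Periodic g T) : ∃ B, ∀ x, ‖g x‖ ≤ B := by
  obtain ⟨B, hB⟩ := (isCompact_Icc (a := 0) (b := T)).exists_bound_of_continuousOn
    hg.continuousOn
  refine ⟨B, fun x => ?_⟩
  obtain ⟨y, hy, e⟩ := hp.exists_mem_Ico₀ hT x
  rw [e]
  exact hB y ⟨hy.1, hy.2.le⟩

lemma sum_geometric_linear_le (K : ℕ) :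
    ∑ k ∈ Finset.range K, (3 / 4 : ℝ) ^ k * (k + 3) ≤ 24 := by
  have : ∑ k ∈ Finset.range K, (3 / 4 : ℝ) ^ k * (k + 3) = 24 - (3 / 4) ^ K * (4 * K + 24) := by
    induction K with
    | zero => norm_num
    | succ K ih => rw [Finset.sum_range_succ, ih]; push_cast; ring
  rw [this]
  have : (0 : ℝ) ≤ (3 / 4) ^ K * (4 * K + 24) := by positivity
  linarith

lemma sum_half_pow_le (N : ℕ) : ∑ j ∈ Finset.range N, (1 / 2 : ℝ) ^ j ≤ 2 := by
  have : ∑ j ∈ Finset.range N, (1 / 2 : ℝ) ^ j = 2 - 2 * (1 / 2) ^ N := by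
    induction N with
    | zero => norm_num
    | succ K ih => rw [Finset.sum_range_succ, ih, pow_succ]; ring
  rw [this]
  have : (0 : ℝ) ≤ (1 / 2) ^ N := by positivity
  linarith

/-- A kernel of size `H / h` with decay `H h³ / t⁴` is dominated by dyadic averages. -/
lemma exists_dyadic_bound {h H : ℝ} (hh : 0 < h) (hH : 0 ≤ H) {t a : ℝ} (N : ℕ)
    (ht : |t| ≤ 2 ^ N * h) (h0 : a ≤ H / h) (h4 : a * t ^ 4 ≤ H * h ^ 3) :
    ∃ j ∈ Finset.range (N + 1), |t| ≤ 2 ^ j * h ∧ a ≤ 16 * H / h * (1 / 16) ^ j := by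
  classical
  have hex : ∃ j, |t| ≤ 2 ^ j * h := ⟨N, ht⟩
  refine ⟨Nat.find hex, Finset.mem_range.2 (Nat.lt_succ_of_le (Nat.find_min' hex ht)),
    Nat.find_spec hex, ?_⟩
  rcases hj : Nat.find hex with _ | j
  · have : 0 ≤ H / h := by positivity
    simp only [pow_zero, mul_one]
    rw [mul_div_assoc]
    linarith
  -- Minimality puts `|t|` above half of the chosen radius; the fourth power of this half is the
  -- factor 16 in the bound.
  · have hlt : 2 ^ j * h < |t| := not_le.1 (Nat.find_min hex (m := j) (by omega))
    have hpos : 0 < 2 ^ j * h := by positivity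
    have h1 : (2 ^ j * h) ^ 4 ≤ t ^ 4 := by
      rw [← Even.pow_abs (n := 4) (by decide) t]
      exact pow_le_pow_left₀ hpos.le hlt.le 4
    have ht4 : 0 < t ^ 4 := lt_of_lt_of_le (by positivity) h1
    have h2 : a ≤ H * h ^ 3 / t ^ 4 := (le_div_iff₀ ht4).2 h4
    refine h2.trans ((div_le_div_of_nonneg_left (by positivity) (by positivity) h1).trans
      (le_of_eq ?_))
    have : ((2 : ℝ) ^ j) ^ 4 = 16 ^ j := by rw [← pow_mul, mul_comm, pow_mul]; norm_num
    rw [mul_pow, this, pow_succ, one_div_pow]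
    field_simp
    ring

/-- Write `f(x+t) - f(x) = w(x+t) - w(x) + (g(x+t) - g(x))` with `g = Ȧ_h f` and `w = f - g`. On the
dyadic scale `|t| ≤ 2^j h` the last increment costs `2^j` windows, and the kernel is at most `16 H /
h · 16^{-j}`. The resulting majorant consists only of `|w(x)|`, centred local integrals of `|w|` and
the remainder in `Ω`. -/
lemma norm_kernel_integral_le {f : ℝ → ℂ} (hf : ∀ a b, IntervalIntegrable f volume a b) {h : ℝ}
    (hh : 0 < h) {Ω : ℝ} (hΩ : ∀ p q, ‖steklovDot h f p - steklovDot h f q‖ ≤ Ω) (K N : ℕ)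
    (hN : Real.pi ≤ 2 ^ N * h) {J : ℝ → ℂ} {H : ℝ} (hH : 0 ≤ H)
    (h0 : ∀ t, |t| ≤ Real.pi → ‖J t‖ ≤ H / h)
    (h4 : ∀ t, |t| ≤ Real.pi → ‖J t‖ * t ^ 4 ≤ H * h ^ 3) (x : ℝ) :
    ‖∫ t in (-Real.pi)..Real.pi, J t * (f (x + t) - f x)‖ ≤
      ∑ j ∈ Finset.range (N + 1), 16 * H / h * (1 / 16) ^ j *
        ((∫ t in (x - 2 ^ j * h)..(x + 2 ^ j * h), ‖(f - steklovDot h f) t‖)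
          + 2 * 2 ^ j * h * (‖(f - steklovDot h f) x‖ + 2 ^ j * ((3 / 4) ^ K * Ω
            + 10 * ∑ k ∈ Finset.range K, (3 / 4) ^ k *
          (h⁻¹ * ∫ t in (x - (2 ^ j + k + 2) * h)..(x + (2 ^ j + k + 2) * h),
            ‖(f - steklovDot h f) t‖)))) := by
  set g := steklovDot h f with hg
  have hgc : Continuous g := continuous_steklovDot hf h
  set w := f - g with hwdef
  have hw : ∀ a b, IntervalIntegrable w volume a b :=
    fun a b => (hf a b).sub (hgc.intervalIntegrable a b)
  set D : ℕ → ℝ := fun j => 2 ^ j * ((3 / 4) ^ K * Ω + 10 * ∑ k ∈ Finset.range K, (3 / 4) ^ k *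
          (h⁻¹ * ∫ t in (x - (2 ^ j + k + 2) * h)..(x + (2 ^ j + k + 2) * h), ‖w t‖)) with hD
  have hgD : ∀ (j : ℕ) (t : ℝ), |t| ≤ 2 ^ j * h → ‖g (x + t) - g x‖ ≤ D j := by
    intro j t ht
    have := norm_steklovDot_sub_le hf hh hΩ K (2 ^ j) x t (by simpa using ht)
    push_cast at this
    exact this
  have hD0 : ∀ j, 0 ≤ D j := fun j => (norm_nonneg _).trans (hgD j 0 (by simp; positivity))
  have hfD : ∀ (j : ℕ) (t : ℝ), |t| ≤ 2 ^ j * h →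
      ‖f (x + t) - f x‖ ≤ ‖w (x + t)‖ + (‖w x‖ + D j) := by
    intro j t ht
    have e : f (x + t) - f x = w (x + t) - (w x - (g (x + t) - g x)) := by
      simp only [hwdef, Pi.sub_apply]; ring
    rw [e]
    exact norm_sub_le_of_le le_rfl (norm_sub_le_of_le le_rfl (hgD j t ht))
  set F : ℕ → ℝ → ℝ := fun j t => 16 * H / h * (1 / 16) ^ j *
    (Set.Icc (-(2 ^ j * h)) (2 ^ j * h)).indicator (fun t => ‖w (x + t)‖ + (‖w x‖ + D j)) t with hF
  have hF0 : ∀ j t, 0 ≤ F j t := fun j t => mul_nonneg (by positivity)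
    (Set.indicator_nonneg (fun t _ => add_nonneg (norm_nonneg _)
      (add_nonneg (norm_nonneg _) (hD0 j))) t)
  have hwx : ∀ a b, IntervalIntegrable (fun t => ‖w (x + t)‖) volume a b := fun a b => by
    simpa using (hw (a + x) (b + x)).norm.comp_add_left x
  have hle : ∀ j : ℕ, -(2 ^ j * h) ≤ 2 ^ j * h := fun j => by
    have : 0 < 2 ^ j * h := by positivity
    linarith
  have hFi : ∀ j, Integrable (F j) volume := by
    intro j
    refine Integrable.const_mul ((integrable_indicator_iff measurableSet_Icc).2 ?_) _
    rw [integrableOn_Icc_iff_integrableOn_Ioc,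
      ← intervalIntegrable_iff_integrableOn_Ioc_of_le (hle j)]
    exact (hwx _ _).add intervalIntegrable_const
  have hFint : ∀ j, ∫ t, F j t = 16 * H / h * (1 / 16) ^ j *
      ((∫ t in (x - 2 ^ j * h)..(x + 2 ^ j * h), ‖w t‖) + 2 * 2 ^ j * h * (‖w x‖ + D j)) := by
    intro j
    simp only [hF]
    rw [integral_const_mul, integral_indicator measurableSet_Icc, integral_Icc_eq_integral_Ioc,
      ← intervalIntegral.integral_of_le (hle j),
      intervalIntegral.integral_add (hwx _ _) intervalIntegrable_const,
      intervalIntegral.integral_comp_add_left (fun t => ‖w t‖) x, intervalIntegral.integral_const,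
      smul_eq_mul, ← sub_eq_add_neg]
    ring
  calc ‖∫ t in (-Real.pi)..Real.pi, J t * (f (x + t) - f x)‖
      ≤ ∫ t in (-Real.pi)..Real.pi, ‖J t * (f (x + t) - f x)‖ :=
        intervalIntegral.norm_integral_le_integral_norm (by linarith [Real.pi_pos])
    _ = ∫ t, (Set.Ioc (-Real.pi) Real.pi).indicator (fun t => ‖J t * (f (x + t) - f x)‖) t := by
        rw [integral_indicator measurableSet_Ioc,
          intervalIntegral.integral_of_le (by linarith [Real.pi_pos])]
    _ ≤ ∫ t, ∑ j ∈ Finset.range (N + 1), F j t := by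
        refine integral_mono_of_nonneg (Eventually.of_forall fun t =>
          Set.indicator_nonneg (fun _ _ => norm_nonneg _) t)
          (integrable_finsetSum _ fun j _ => hFi j) (Eventually.of_forall fun t => ?_)
        simp only
        by_cases ht : t ∈ Set.Ioc (-Real.pi) Real.pi
        · have ht' : |t| ≤ Real.pi := abs_le.2 ⟨ht.1.le, ht.2⟩
          obtain ⟨j, hj, hj1, hj2⟩ := exists_dyadic_bound hh hH N (ht'.trans hN) (h0 t ht')
            (h4 t ht')
          rw [Set.indicator_of_mem ht, norm_mul]
          -- For each `t` the one scale supplied by `exists_dyadic_bound` already dominates; the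
          -- other terms are nonnegative.
          refine le_trans ?_ (Finset.single_le_sum (f := fun j => F j t) (fun j _ => hF0 j t) hj)
          simp only [hF]
          rw [Set.indicator_of_mem (Set.mem_Icc.2 (abs_le.1 hj1))]
          exact mul_le_mul hj2 (hfD j t hj1) (norm_nonneg _) (by positivity)
        · rw [Set.indicator_of_notMem ht]
          exact Finset.sum_nonneg fun j _ => hF0 j t
    _ = _ := by
        rw [integral_finsetSum _ fun j _ => hFi j]
        exact Finset.sum_congr rfl fun j _ => hFint j

namespace PeriodicBanachLattice

variable {X : PeriodicBanachLattice} {M : ℝ≥0}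
  (hM : ∀ h : ℝ, 0 < h → ∀ f, X.Mem f → X.norm (steklov h f) ≤ M * X.norm f)
include hM

lemma mem_steklov {f : ℝ → ℂ} (hf : X.Mem f) {h : ℝ} (hh : 0 < h) :
    X.Mem (steklov h f) ∧ X.nrm (steklov h f) ≤ M * X.nrm f := by
  have h1 := hM h hh f hf
  refine ⟨h1.trans_lt (ENNReal.mul_lt_top (by simp) hf), ?_⟩
  have := ENNReal.toReal_mono (ENNReal.mul_ne_top (by simp) hf.ne) h1
  simpa [nrm, ENNReal.toReal_mul] using this

/-- The window `[x, x+h]` lies in the centred window of length `2h`; this replaces a translation and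
costs the factor 2. -/
lemma mem_steklovDot {f : ℝ → ℂ} (hf : X.Mem f) {h : ℝ} (hh : 0 < h) :
    X.Mem (steklovDot h f) ∧ X.nrm (steklovDot h f) ≤ 2 * M * X.nrm f := by
  have hc := continuous_steklovDot hf.intervalIntegrable h
  have := ((hf.bdd_local hM hh).const_mul (inv_nonneg.2 hh.le)).bound
    hc.aestronglyMeasurable (periodic_steklovDot hf.per h) fun x => by
      rw [steklovDot_eq, norm_mul, norm_inv, Complex.norm_of_nonneg hh.le]
      exact mul_le_mul_of_nonneg_left (norm_integral_le_of_subset hf.intervalIntegrable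
        (by linarith) (by linarith) le_rfl) (inv_nonneg.2 hh.le)
  refine ⟨this.1, this.2.trans (le_of_eq ?_)⟩
  field_simp

/-- Convolution differences with a rapidly decaying kernel are controlled by `f - Ȧ_h f`. -/
lemma Mem.nrm_kernel_integral_le {f : ℝ → ℂ} (hf : X.Mem f) {h : ℝ} (hh : 0 < h)
    {J : ℝ → ℂ} {H : ℝ} (hH : 0 ≤ H)
    (h0 : ∀ t, |t| ≤ Real.pi → ‖J t‖ ≤ H / h)
    (h4 : ∀ t, |t| ≤ Real.pi → ‖J t‖ * t ^ 4 ≤ H * h ^ 3) {Φ : ℝ → ℂ}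
    (hΦ : ∀ x, Φ x = ∫ t in (-Real.pi)..Real.pi, J t * (f (x + t) - f x))
    (hm : AEStronglyMeasurable Φ volume) (hp : Function.Periodic Φ (2 * Real.pi)) :
    X.nrm Φ ≤ 64 * H * (481 * M + 1) * X.nrm (f - steklovDot h f) := by
  have hg := mem_steklovDot hM hf hh
  have hw := hf.sub hg.1
  set w := f - steklovDot h f with hwdef
  set W := X.nrm w with hW
  have hW0 : 0 ≤ W := nrm_nonneg _
  set κ := X.nrm fun _ => 1 with hκ
  have hκ0 : 0 ≤ κ := nrm_nonneg _
  obtain ⟨B, hB⟩ := hg.1.per.exists_norm_le (continuous_steklovDot hf.intervalIntegrable h)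
    Real.two_pi_pos
  have hΩ : ∀ p q, ‖steklovDot h f p - steklovDot h f q‖ ≤ B + B :=
    fun p q => norm_sub_le_of_le (hB p) (hB q)
  set Ω := B + B with hΩdef
  have hΩ0 : 0 ≤ Ω := (norm_nonneg _).trans (hΩ 0 0)
  obtain ⟨N, hN⟩ : ∃ N : ℕ, Real.pi ≤ 2 ^ N * h := by
    obtain ⟨N, hN⟩ := pow_unbounded_of_one_lt (Real.pi / h) (one_lt_two : (1 : ℝ) < 2)
    exact ⟨N, ((div_lt_iff₀ hh).1 hN).le⟩
  have key : ∀ K : ℕ, X.nrm Φ ≤ 64 * H * ((481 * M + 1) * W + (3 / 4) ^ K * (Ω * κ)) := by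
    intro K
    have hbdd := Bdd.sum (X := X) (Finset.range (N + 1)) fun j _ =>
      (Bdd.const_mul (c := 16 * H / h * (1 / 16) ^ j) (by positivity)
        ((hw.bdd_local hM (a := 2 ^ j * h) (by positivity)).add
          (Bdd.const_mul (c := 2 * 2 ^ j * h) (by positivity) (hw.bdd_norm.add
            (Bdd.const_mul (c := 2 ^ j) (by positivity)
              ((bdd_const (c := (3 / 4) ^ K * Ω) (by positivity)).add
                (Bdd.const_mul (c := 10) (by norm_num) (Bdd.sum (Finset.range K) fun k _ =>
                  (Bdd.const_mul (c := (3 / 4) ^ k) (by positivity)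
                    (Bdd.const_mul (c := h⁻¹) (by positivity)
                      (hw.bdd_local hM (a := (2 ^ j + k + 2) * h) (by positivity))))))))))))
    refine ((hbdd.bound hm hp fun x => ?_).2).trans ?_
    · rw [hΦ]
      exact norm_kernel_integral_le hf.intervalIntegrable hh hΩ K N hN hH h0 h4 x
    -- Three factors `2^j` occur: the length of the `t`-range, the number of windows in the chain,
    -- and the radius of the enlarged windows. Against `16^{-j}` they leave the summable `2^{-j}`,
    -- which is why fourth-order decay is asked for. The constant is `481 = 1 + 10 · 48` with `48 =
    -- 2 · 24`.
    · have hj : ∀ j : ℕ, 16 * H / h * (1 / 16) ^ j * (2 * (2 ^ j * h) * (M * W) + 2 * 2 ^ j * h *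
          (W + 2 ^ j * ((3 / 4) ^ K * Ω * κ + 10 * ∑ k ∈ Finset.range K, (3 / 4) ^ k *
            (h⁻¹ * (2 * ((2 ^ j + k + 2) * h) * (M * W))))))
          ≤ 32 * H * ((481 * M + 1) * W + (3 / 4) ^ K * (Ω * κ)) * (1 / 2) ^ j := by
        intro j
        have h1j : (1 : ℝ) ≤ 2 ^ j := one_le_pow₀ (by norm_num)
        have hMW : 0 ≤ M * W := by positivity
        have hs : ∑ k ∈ Finset.range K, (3 / 4 : ℝ) ^ k *
            (h⁻¹ * (2 * ((2 ^ j + k + 2) * h) * (M * W))) ≤ 2 ^ j * (48 * (M * W)) := by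
          calc _ ≤ ∑ k ∈ Finset.range K, 2 ^ j * (2 * (M * W)) * ((3 / 4 : ℝ) ^ k * (k + 3)) := by
                refine Finset.sum_le_sum fun k _ => ?_
                have e : h⁻¹ * (2 * ((2 ^ j + k + 2) * h) * (M * W))
                    = 2 * (M * W) * (2 ^ j + k + 2) := by field_simp
                have h2 : (2 : ℝ) ^ j + k + 2 ≤ 2 ^ j * (k + 3) := by
                  have : (0 : ℝ) ≤ k := by positivity
                  nlinarith
                rw [e]
                calc _ ≤ (3 / 4 : ℝ) ^ k * (2 * (M * W) * (2 ^ j * (k + 3))) := by gcongr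
                  _ = _ := by ring
            _ ≤ 2 ^ j * (2 * (M * W)) * 24 := by
                rw [← Finset.mul_sum]
                exact mul_le_mul_of_nonneg_left (sum_geometric_linear_le K) (by positivity)
            _ = _ := by ring
        set Θ := (3 / 4) ^ K * (Ω * κ) with hΘ
        have hΘ0 : 0 ≤ Θ := by positivity
        have e3 : (1 / 2 : ℝ) ^ j = (1 / 16) ^ j * (2 ^ j * (2 ^ j * 2 ^ j)) := by
          rw [← mul_pow, ← mul_pow, ← mul_pow]; norm_num
        have hbr : M * W + (W + 2 ^ j * (Θ + 10 * (2 ^ j * (48 * (M * W)))))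
            ≤ (2 ^ j * 2 ^ j) * ((481 * M + 1) * W + Θ) := by
          have h2j : (2 : ℝ) ^ j ≤ 2 ^ j * 2 ^ j := by nlinarith
          have h3j : (1 : ℝ) ≤ 2 ^ j * 2 ^ j := by nlinarith
          nlinarith [mul_le_mul_of_nonneg_right h2j hΘ0, mul_le_mul_of_nonneg_right h3j hMW,
            mul_le_mul_of_nonneg_right h3j hW0]
        calc _ = 32 * H * (1 / 16) ^ j * 2 ^ j * (M * W +
              (W + 2 ^ j * (Θ + 10 * ∑ k ∈ Finset.range K, (3 / 4 : ℝ) ^ k *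
                (h⁻¹ * (2 * ((2 ^ j + k + 2) * h) * (M * W)))))) := by
              rw [hΘ]; field_simp; ring
          _ ≤ 32 * H * (1 / 16) ^ j * 2 ^ j *
              ((2 ^ j * 2 ^ j) * ((481 * M + 1) * W + Θ)) := by
              refine mul_le_mul_of_nonneg_left (le_trans ?_ hbr) (by positivity)
              gcongr
          _ = _ := by rw [e3]; ring
      refine (Finset.sum_le_sum fun j _ => hj j).trans ?_
      rw [← Finset.mul_sum]
      refine (mul_le_mul_of_nonneg_left (sum_half_pow_le _) (by positivity)).trans (le_of_eq ?_)
      ring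
  -- The bound `Ω` depends on `f` without control; letting `K → ∞` removes it.
  have hlim : Tendsto (fun K : ℕ => 64 * H * ((481 * M + 1) * W + (3 / 4) ^ K * (Ω * κ))) atTop
      (𝓝 (64 * H * ((481 * M + 1) * W + 0 * (Ω * κ)))) :=
    ((tendsto_pow_atTop_nhds_zero_of_lt_one (by norm_num) (by norm_num)).mul_const _
      |>.const_add _).const_mul _
  have := ge_of_tendsto' hlim key
  simpa [mul_assoc] using this

end PeriodicBanachLattice

/-! ### Characters and trigonometric polynomials -/

/-- The character `x ↦ e^{ikx}`. -/
def expChar (k : ℤ) (x : ℝ) : ℂ := Complex.exp (Complex.I * k * x)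

lemma expChar_add (k l : ℤ) (x : ℝ) : expChar (k + l) x = expChar k x * expChar l x := by
  simp only [expChar, ← Complex.exp_add]
  congr 1; push_cast; ring

lemma expChar_add_right (k : ℤ) (x y : ℝ) : expChar k (x + y) = expChar k x * expChar k y := by
  simp only [expChar, ← Complex.exp_add]
  congr 1; push_cast; ring

@[simp] lemma expChar_zero (x : ℝ) : expChar 0 x = 1 := by simp [expChar]

@[simp] lemma norm_expChar (k : ℤ) (x : ℝ) : ‖expChar k x‖ = 1 := by
  rw [expChar, show Complex.I * k * x = ((k * x : ℝ) : ℂ) * Complex.I by push_cast; ring,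
    Complex.norm_exp_ofReal_mul_I]

lemma hasDerivAt_expChar (k : ℤ) (x : ℝ) :
    HasDerivAt (expChar k) (Complex.I * k * expChar k x) x := by
  have h1 : HasDerivAt (fun y : ℝ => Complex.I * k * (y : ℂ)) (Complex.I * k * 1) x :=
    (Complex.ofRealCLM.hasDerivAt (x := x)).const_mul _
  exact h1.cexp.congr_deriv (by rw [mul_one, mul_comm]; rfl)

@[fun_prop] lemma continuous_expChar (k : ℤ) : Continuous (expChar k) :=
  continuous_iff_continuousAt.2 fun x => (hasDerivAt_expChar k x).continuousAt

lemma periodic_expChar (k : ℤ) : Function.Periodic (expChar k) (2 * Real.pi) := by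
  intro x
  rw [expChar_add_right]
  have : expChar k (2 * Real.pi) = 1 := by
    rw [expChar, Complex.exp_eq_one_iff]
    exact ⟨k, by push_cast; ring⟩
  rw [this, mul_one]

lemma integral_expChar (k : ℤ) :
    ∫ t in (-Real.pi)..Real.pi, expChar k t = if k = 0 then 2 * (Real.pi : ℂ) else 0 := by
  split_ifs with hk
  · subst hk
    simp only [expChar_zero, intervalIntegral.integral_const, Complex.real_smul]
    push_cast; ring
  · have hc : Complex.I * k ≠ 0 := by simp [hk]
    have hd : ∀ x ∈ Set.uIcc (-Real.pi) Real.pi,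
        HasDerivAt (fun y => (Complex.I * k)⁻¹ * expChar k y) (expChar k x) x := fun x _ => by
      have := (hasDerivAt_expChar k x).const_mul (Complex.I * k)⁻¹
      rwa [inv_mul_cancel_left₀ hc] at this
    rw [intervalIntegral.integral_eq_sub_of_hasDerivAt hd
      ((continuous_expChar k).intervalIntegrable _ _)]
    have := periodic_expChar k (-Real.pi)
    rw [show -Real.pi + 2 * Real.pi = Real.pi by ring] at this
    rw [this, sub_self]

/-- The trigonometric polynomials of degree at most `n` as a subspace. -/
def trigPolySubmodule (n : ℕ) : Submodule ℂ (ℝ → ℂ) where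
  carrier := trigPoly n
  add_mem' := by
    rintro S T ⟨c, hc⟩ ⟨d, hd⟩
    exact ⟨c + d, fun x => by simp [hc, hd, add_mul, Finset.sum_add_distrib]⟩
  zero_mem' := ⟨0, fun x => by simp⟩
  smul_mem' := by
    rintro a T ⟨c, hc⟩
    exact ⟨a • c, fun x => by simp [hc, Finset.mul_sum, mul_assoc]⟩

lemma mem_trigPolySubmodule {n : ℕ} {T : ℝ → ℂ} : T ∈ trigPolySubmodule n ↔ T ∈ trigPoly n :=
  Iff.rfl

lemma expChar_mem_trigPoly {n : ℕ} {k : ℤ} (hk : |k| ≤ n) : expChar k ∈ trigPoly n := by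
  classical
  refine ⟨Pi.single k 1, fun x => ?_⟩
  rw [Finset.sum_eq_single k]
  · simp [expChar]
  · intro l _ hl
    simp [hl]
  · intro h
    exact absurd (Finset.mem_Icc.2 (abs_le.1 hk)) h

lemma exists_coeff_of_mem_trigPoly {n : ℕ} {T : ℝ → ℂ} (hT : T ∈ trigPoly n) :
    ∃ c : ℤ → ℂ, T = ∑ k ∈ Finset.Icc (-(n : ℤ)) n, c k • expChar k := by
  obtain ⟨c, hc⟩ := hT
  exact ⟨c, by ext x; simp [hc, expChar]⟩

lemma hasDerivAt_sum_expChar (s : Finset ℤ) (c : ℤ → ℂ) (x : ℝ) :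
    HasDerivAt (∑ k ∈ s, c k • expChar k)
      ((∑ k ∈ s, c k • ((Complex.I * k) • expChar k)) x) x := by
  have := HasDerivAt.sum (u := s) (A := fun k => c k • expChar k) (x := x) fun k _ =>
    (hasDerivAt_expChar k x).const_smul (c k)
  simpa using this

lemma deriv_sum_expChar (s : Finset ℤ) (c : ℤ → ℂ) :
    deriv (∑ k ∈ s, c k • expChar k) = ∑ k ∈ s, c k • ((Complex.I * k) • expChar k) :=
  funext fun x => (hasDerivAt_sum_expChar s c x).deriv

section TrigPoly

variable {n : ℕ} {T : ℝ → ℂ} (hT : T ∈ trigPoly n)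
include hT

lemma differentiable_of_mem_trigPoly : Differentiable ℝ T := by
  obtain ⟨c, rfl⟩ := exists_coeff_of_mem_trigPoly hT
  exact fun x => (hasDerivAt_sum_expChar _ c x).differentiableAt

lemma continuous_of_mem_trigPoly : Continuous T := (differentiable_of_mem_trigPoly hT).continuous

lemma deriv_mem_trigPoly : deriv T ∈ trigPoly n := by
  obtain ⟨c, rfl⟩ := exists_coeff_of_mem_trigPoly hT
  rw [deriv_sum_expChar]
  exact mem_trigPolySubmodule.1 (sum_mem fun k hkn => Submodule.smul_mem _ _
    (Submodule.smul_mem _ _ (expChar_mem_trigPoly (abs_le.2 (Finset.mem_Icc.1 hkn)))))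

lemma periodic_of_mem_trigPoly : Function.Periodic T (2 * Real.pi) := by
  obtain ⟨c, rfl⟩ := exists_coeff_of_mem_trigPoly hT
  intro x
  simp [periodic_expChar _ x]

lemma iteratedDeriv_mem_trigPoly (j : ℕ) : iteratedDeriv j T ∈ trigPoly n := by
  induction j with
  | zero => simpa using hT
  | succ j ih => rw [iteratedDeriv_succ]; exact deriv_mem_trigPoly ih

lemma PeriodicBanachLattice.mem_of_mem_trigPoly {X : PeriodicBanachLattice} : X.Mem T := by
  obtain ⟨B, hB⟩ := (periodic_of_mem_trigPoly hT).exists_norm_le (continuous_of_mem_trigPoly hT)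
    Real.two_pi_pos
  exact mem_of_bounded (continuous_of_mem_trigPoly hT).aestronglyMeasurable
    (periodic_of_mem_trigPoly hT) hB

lemma integral_deriv_of_mem_trigPoly (a b : ℝ) : ∫ t in a..b, deriv T t = T b - T a :=
  intervalIntegral.integral_deriv_eq_sub
    (fun x _ => differentiable_of_mem_trigPoly hT x)
    ((continuous_of_mem_trigPoly (deriv_mem_trigPoly hT)).intervalIntegrable _ _)

end TrigPoly

/-! ### Dirichlet sums and Jackson-type kernels -/

/-- The one-sided Dirichlet sum `∑_{k<a} e^{ikt}`. -/
def dirSum (a : ℕ) (t : ℝ) : ℂ := ∑ k ∈ Finset.range a, expChar k t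

/-- The derivative of the one-sided Dirichlet sum. -/
def dirSumDeriv (a : ℕ) (t : ℝ) : ℂ := ∑ k ∈ Finset.range a, Complex.I * k * expChar k t

lemma hasDerivAt_dirSum (a : ℕ) (t : ℝ) : HasDerivAt (dirSum a) (dirSumDeriv a t) t := by
  have := HasDerivAt.fun_sum (u := Finset.range a) (A := fun k : ℕ => expChar k) (x := t)
    fun k _ => hasDerivAt_expChar k t
  simp only [Int.cast_natCast] at this
  exact this

lemma norm_dirSum_le (a : ℕ) (t : ℝ) : ‖dirSum a t‖ ≤ a :=
  (norm_sum_le _ _).trans (by simp)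

lemma norm_dirSumDeriv_le (a : ℕ) (t : ℝ) : ‖dirSumDeriv a t‖ ≤ a * a := by
  refine (norm_sum_le_of_le _ (n := fun _ => (a : ℝ)) fun k hk => ?_).trans (by simp)
  have : (k : ℝ) ≤ a := by exact_mod_cast (Finset.mem_range.1 hk).le
  simpa using this

lemma expChar_natCast (k : ℕ) (t : ℝ) : expChar k t = expChar 1 t ^ k := by
  simp only [expChar, ← Complex.exp_nat_mul]
  congr 1; push_cast; ring

lemma dirSum_mul (a : ℕ) (t : ℝ) : dirSum a t * (expChar 1 t - 1) = expChar a t - 1 := by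
  have := geom_sum_mul (expChar 1 t) a
  simpa [dirSum, expChar_natCast] using this

/-- Differentiate the closed form `dirSum_mul` and compare the two derivatives. -/
lemma dirSumDeriv_mul (a : ℕ) (t : ℝ) :
    dirSumDeriv a t * (expChar 1 t - 1)
      = Complex.I * a * expChar a t - dirSum a t * (Complex.I * expChar 1 t) := by
  have h1 : HasDerivAt (fun t => dirSum a t * (expChar 1 t - 1))
      (dirSumDeriv a t * (expChar 1 t - 1) + dirSum a t * (Complex.I * (1 : ℤ) * expChar 1 t)) t :=
    (hasDerivAt_dirSum a t).mul ((hasDerivAt_expChar 1 t).sub_const 1)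
  have h2 : HasDerivAt (fun t => dirSum a t * (expChar 1 t - 1))
      (Complex.I * (a : ℤ) * expChar a t) t := by
    simp only [dirSum_mul]
    exact (hasDerivAt_expChar a t).sub_const 1
  have := h1.unique h2
  push_cast at this
  linear_combination this

lemma le_norm_expChar_sub_one {t : ℝ} (ht : |t| ≤ Real.pi) :
    2 / Real.pi * |t| ≤ ‖expChar 1 t - 1‖ := by
  have h1 : ‖expChar 1 t - 1‖ = ‖2 * Real.sin (t / 2)‖ := by
    rw [← Complex.norm_exp_I_mul_ofReal_sub_one]; simp [expChar]
  have h2 := Real.mul_abs_le_abs_sin (x := t / 2) (by rw [abs_div]; simp; linarith)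
  rw [h1, norm_mul, Real.norm_eq_abs, Real.norm_eq_abs]
  rw [abs_div] at h2
  simp only [Nat.abs_ofNat] at h2 ⊢
  have : 2 / Real.pi * (|t| / 2) = (2 / Real.pi * |t|) / 2 := by ring
  linarith

lemma norm_mul_abs_le_of_mul_expChar {t B : ℝ} (ht : |t| ≤ Real.pi) {z : ℂ}
    (hz : ‖z * (expChar 1 t - 1)‖ ≤ 2 * B) : ‖z‖ * |t| ≤ Real.pi * B := by
  rw [norm_mul] at hz
  have h1 := mul_le_mul_of_nonneg_left (le_norm_expChar_sub_one ht) (norm_nonneg z)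
  have h2 := h1.trans hz
  have h3 : ‖z‖ * (2 / Real.pi * |t|) = 2 * (‖z‖ * |t|) / Real.pi := by ring
  rw [h3, div_le_iff₀ Real.pi_pos] at h2
  linarith

lemma norm_dirSum_mul_abs_le (a : ℕ) {t : ℝ} (ht : |t| ≤ Real.pi) :
    ‖dirSum a t‖ * |t| ≤ Real.pi := by
  have := norm_mul_abs_le_of_mul_expChar (B := 1) ht (z := dirSum a t) (by
    rw [dirSum_mul]
    exact (norm_sub_le _ _).trans (by simp; norm_num))
  simpa using this

lemma norm_dirSumDeriv_mul_abs_le (a : ℕ) {t : ℝ} (ht : |t| ≤ Real.pi) :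
    ‖dirSumDeriv a t‖ * |t| ≤ Real.pi * a := by
  refine norm_mul_abs_le_of_mul_expChar ht ?_
  rw [dirSumDeriv_mul]
  refine (norm_sub_le _ _).trans ?_
  have := norm_dirSum_le a t
  simp only [norm_mul, Complex.norm_I, one_mul, norm_expChar, mul_one, Complex.norm_natCast]
  linarith

/-- A Jackson-type kernel `(2π b³)⁻¹ e^{-ict} σ_a(t) σ_b(t)³` with `b = β + 1`, `a = 3β + 2q + 1`,
`c = 3β + q`, whose Fourier coefficients are `1` for the frequencies `|k| ≤ q`. -/
def jackson (β q : ℕ) (t : ℝ) : ℂ :=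
  (2 * Real.pi * (β + 1 : ℕ) ^ 3 : ℂ)⁻¹ *
    (expChar (-(3 * β + q : ℕ)) t * (dirSum (3 * β + 2 * q + 1) t * dirSum (β + 1) t ^ 3))

/-- The derivative of the kernel `jackson`. -/
def jacksonDeriv (β q : ℕ) (t : ℝ) : ℂ :=
  (2 * Real.pi * (β + 1 : ℕ) ^ 3 : ℂ)⁻¹ *
    (Complex.I * (-(3 * β + q : ℕ) : ℤ) * expChar (-(3 * β + q : ℕ)) t *
        (dirSum (3 * β + 2 * q + 1) t * dirSum (β + 1) t ^ 3)
      + expChar (-(3 * β + q : ℕ)) t *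
        (dirSumDeriv (3 * β + 2 * q + 1) t * dirSum (β + 1) t ^ 3
          + dirSum (3 * β + 2 * q + 1) t * (3 * dirSum (β + 1) t ^ 2 * dirSumDeriv (β + 1) t)))

lemma hasDerivAt_jackson (β q : ℕ) (t : ℝ) :
    HasDerivAt (jackson β q) (jacksonDeriv β q t) t := by
  have h3 : HasDerivAt (fun t => dirSum (β + 1) t ^ 3)
      (3 * dirSum (β + 1) t ^ 2 * dirSumDeriv (β + 1) t) t := by
    simpa using (hasDerivAt_dirSum (β + 1) t).fun_pow 3
  exact ((hasDerivAt_expChar _ t).mul ((hasDerivAt_dirSum _ t).mul h3)).const_mul _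

/-- The index set of the Fourier expansion of `jackson`. -/
def jacksonIndex (β q : ℕ) : Finset (ℕ × ℕ × ℕ × ℕ) :=
  Finset.range (3 * β + 2 * q + 1) ×ˢ Finset.range (β + 1) ×ˢ Finset.range (β + 1) ×ˢ
    Finset.range (β + 1)

lemma jackson_eq_sum (β q : ℕ) : jackson β q = (2 * Real.pi * (β + 1 : ℕ) ^ 3 : ℂ)⁻¹ •
    ∑ p ∈ jacksonIndex β q,
      expChar ((p.1 + (p.2.1 + (p.2.2.1 + p.2.2.2)) : ℕ) - (3 * β + q : ℕ)) := by
  ext t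
  simp only [jackson, jacksonIndex, Pi.smul_apply, Finset.sum_apply, smul_eq_mul]
  congr 1
  simp only [Finset.sum_product, sub_eq_add_neg, expChar_add, Nat.cast_add, ← Finset.sum_mul,
    ← Finset.mul_sum, dirSum]
  ring

lemma jackson_mem_trigPoly (β q : ℕ) : jackson β q ∈ trigPoly (3 * β + q) := by
  rw [jackson_eq_sum]
  refine mem_trigPolySubmodule.1 (Submodule.smul_mem _ _ (sum_mem fun p hp =>
    expChar_mem_trigPoly ?_))
  simp only [jacksonIndex, Finset.mem_product, Finset.mem_range] at hp
  rw [abs_le]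
  constructor <;> push_cast <;> omega

/-- The integral counts the exponent quadruples whose total frequency cancels `k`. Each choice of
the three short exponents leaves exactly one admissible long exponent, so there are `(β+1)³` of
them, which the prefactor normalises. -/
lemma integral_jackson_mul_expChar (β q : ℕ) {k : ℤ} (hk : |k| ≤ q) :
    ∫ t in (-Real.pi)..Real.pi, jackson β q t * expChar k t = 1 := by
  have hk' := abs_le.1 hk
  have e : ∀ t, jackson β q t * expChar k t = (2 * Real.pi * (β + 1 : ℕ) ^ 3 : ℂ)⁻¹ *
      ∑ p ∈ jacksonIndex β q,
        expChar ((p.1 + (p.2.1 + (p.2.2.1 + p.2.2.2)) : ℕ) - (3 * β + q : ℕ) + k) t := by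
    intro t
    rw [jackson_eq_sum]
    simp only [Pi.smul_apply, Finset.sum_apply, smul_eq_mul, mul_assoc, Finset.sum_mul, expChar_add]
  simp only [e]
  rw [intervalIntegral.integral_const_mul, intervalIntegral.integral_finsetSum
    fun p _ => (continuous_expChar _).intervalIntegrable _ _]
  simp only [integral_expChar]
  have hinner : ∀ y ∈ Finset.range (β + 1) ×ˢ Finset.range (β + 1) ×ˢ Finset.range (β + 1),
      ∑ i ∈ Finset.range (3 * β + 2 * q + 1),
        (if ((i + (y.1 + (y.2.1 + y.2.2)) : ℕ) : ℤ) - (3 * β + q : ℕ) + k = 0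
          then 2 * (Real.pi : ℂ) else 0) = 2 * Real.pi := by
    intro y hy
    simp only [Finset.mem_product, Finset.mem_range] at hy
    -- This exponent lies in `[0, 3β + 2q]`, because `|k| ≤ q` and the three short exponents add up
    -- to at most `3β`.
    rw [Finset.sum_eq_single (((3 * β + q : ℕ) : ℤ) - k - (y.1 + (y.2.1 + y.2.2) : ℕ)).toNat]
    · rw [if_pos]; push_cast; omega
    · intro i _ hi
      rw [if_neg]; push_cast at hi ⊢; omega
    · intro hni
      exfalso
      apply hni
      rw [Finset.mem_range]
      push_cast; omega
  rw [jacksonIndex, Finset.sum_product_right, Finset.sum_congr rfl hinner]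
  have hpi : (Real.pi : ℂ) ≠ 0 := by exact_mod_cast Real.pi_ne_zero
  have hb : ((β + 1 : ℕ) : ℂ) ≠ 0 := by exact_mod_cast Nat.succ_ne_zero β
  simp only [Finset.sum_const, Finset.card_product, Finset.card_range, nsmul_eq_mul]
  push_cast at hb ⊢
  field_simp

lemma norm_jackson_prefactor (β : ℕ) : ‖(2 * Real.pi * (β + 1 : ℕ) ^ 3 : ℂ)⁻¹‖
    = (2 * Real.pi * (β + 1) ^ 3)⁻¹ := by
  rw [norm_inv, norm_mul, norm_mul, norm_pow, Complex.norm_natCast, Complex.norm_real,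
    Real.norm_of_nonneg Real.pi_pos.le]
  simp

lemma norm_jackson_le (β q : ℕ) (t : ℝ) :
    ‖jackson β q t‖ ≤ (2 * Real.pi * (β + 1) ^ 3)⁻¹ *
      ((3 * β + 2 * q + 1) * (β + 1) ^ 3) := by
  have ha := norm_dirSum_le (3 * β + 2 * q + 1) t
  have hb := norm_dirSum_le (β + 1) t
  push_cast at ha hb
  rw [jackson, norm_mul, norm_jackson_prefactor, norm_mul, norm_expChar, one_mul, norm_mul,
    norm_pow]
  have := Real.pi_pos
  gcongr

lemma norm_jackson_mul_pow_le (β q : ℕ) {t : ℝ} (ht : |t| ≤ Real.pi) :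
    ‖jackson β q t‖ * t ^ 4 ≤ (2 * Real.pi * (β + 1) ^ 3)⁻¹ * Real.pi ^ 4 := by
  have ha := norm_dirSum_mul_abs_le (3 * β + 2 * q + 1) ht
  have hb := norm_dirSum_mul_abs_le (β + 1) ht
  rw [jackson, norm_mul, norm_jackson_prefactor, norm_mul, norm_expChar, one_mul, norm_mul,
    norm_pow, ← Even.pow_abs (n := 4) (by decide) t]
  have := Real.pi_pos
  calc _ = (2 * Real.pi * (β + 1) ^ 3)⁻¹ * ((‖dirSum (3 * β + 2 * q + 1) t‖ * |t|) *
        (‖dirSum (β + 1) t‖ * |t|) ^ 3) := by ring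
    _ ≤ (2 * Real.pi * (β + 1) ^ 3)⁻¹ * (Real.pi * Real.pi ^ 3) := by gcongr
    _ = _ := by ring

lemma norm_jacksonDeriv_le_aux (β q : ℕ) (t : ℝ) :
    ‖jacksonDeriv β q t‖ ≤ (2 * Real.pi * (β + 1) ^ 3)⁻¹ *
      ((3 * β + q) * (‖dirSum (3 * β + 2 * q + 1) t‖ * ‖dirSum (β + 1) t‖ ^ 3)
        + (‖dirSumDeriv (3 * β + 2 * q + 1) t‖ * ‖dirSum (β + 1) t‖ ^ 3
          + ‖dirSum (3 * β + 2 * q + 1) t‖ *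
            (3 * ‖dirSum (β + 1) t‖ ^ 2 * ‖dirSumDeriv (β + 1) t‖))) := by
  rw [jacksonDeriv, norm_mul, norm_jackson_prefactor]
  have := Real.pi_pos
  refine mul_le_mul_of_nonneg_left ?_ (by positivity)
  refine (norm_add_le _ _).trans (add_le_add (le_of_eq ?_) ?_)
  · simp only [norm_mul, norm_expChar, Complex.norm_I, one_mul, mul_one, norm_pow]
    congr 1
    rw [Complex.norm_intCast]
    push_cast
    rw [abs_of_nonpos (by linarith [(Nat.cast_nonneg β : (0 : ℝ) ≤ β),
      (Nat.cast_nonneg q : (0 : ℝ) ≤ q)])]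
    ring
  · rw [norm_mul, norm_expChar, one_mul]
    refine (norm_add_le _ _).trans (le_of_eq ?_)
    simp only [norm_mul, norm_pow]
    norm_num

lemma norm_jacksonDeriv_le (β q : ℕ) (t : ℝ) :
    ‖jacksonDeriv β q t‖ ≤ (2 * Real.pi * (β + 1) ^ 3)⁻¹ *
      ((3 * β + 2 * q + 1) * (β + 1) ^ 3 * ((3 * β + q) + (3 * β + 2 * q + 1) + 3 * (β + 1))) := by
  have ha := norm_dirSum_le (3 * β + 2 * q + 1) t
  have hb := norm_dirSum_le (β + 1) t
  have ha' := norm_dirSumDeriv_le (3 * β + 2 * q + 1) t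
  have hb' := norm_dirSumDeriv_le (β + 1) t
  push_cast at ha hb ha' hb'
  refine (norm_jacksonDeriv_le_aux β q t).trans ?_
  have := Real.pi_pos
  refine mul_le_mul_of_nonneg_left ?_ (by positivity)
  calc _ ≤ (3 * β + q) * ((3 * β + 2 * q + 1) * ((β : ℝ) + 1) ^ 3)
        + ((3 * β + 2 * q + 1) * (3 * β + 2 * q + 1) * ((β : ℝ) + 1) ^ 3
          + (3 * β + 2 * q + 1) * (3 * ((β : ℝ) + 1) ^ 2 * ((β + 1) * (β + 1)))) := by gcongr
    _ = _ := by ring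

lemma norm_jacksonDeriv_mul_pow_le (β q : ℕ) {t : ℝ} (ht : |t| ≤ Real.pi) :
    ‖jacksonDeriv β q t‖ * t ^ 4 ≤ (2 * Real.pi * (β + 1) ^ 3)⁻¹ *
      (Real.pi ^ 4 * ((3 * β + q) + (3 * β + 2 * q + 1) + 3 * (β + 1))) := by
  have ha := norm_dirSum_mul_abs_le (3 * β + 2 * q + 1) ht
  have hb := norm_dirSum_mul_abs_le (β + 1) ht
  have ha' := norm_dirSumDeriv_mul_abs_le (3 * β + 2 * q + 1) ht
  have hb' := norm_dirSumDeriv_mul_abs_le (β + 1) ht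
  push_cast at ha' hb'
  rw [← Even.pow_abs (n := 4) (by decide) t]
  refine (mul_le_mul_of_nonneg_right (norm_jacksonDeriv_le_aux β q t) (by positivity)).trans ?_
  rw [mul_assoc]
  have := Real.pi_pos
  refine mul_le_mul_of_nonneg_left ?_ (by positivity)
  set A := ‖dirSum (3 * β + 2 * q + 1) t‖
  set B := ‖dirSum (β + 1) t‖
  set A' := ‖dirSumDeriv (3 * β + 2 * q + 1) t‖
  set B' := ‖dirSumDeriv (β + 1) t‖
  calc _ = (3 * β + q) * ((A * |t|) * (B * |t|) ^ 3) + ((A' * |t|) * (B * |t|) ^ 3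
        + (A * |t|) * (3 * (B * |t|) ^ 2 * (B' * |t|))) := by ring
    _ ≤ (3 * β + q) * (Real.pi * Real.pi ^ 3) + ((Real.pi * (3 * β + 2 * q + 1)) * Real.pi ^ 3
        + Real.pi * (3 * Real.pi ^ 2 * (Real.pi * (β + 1)))) := by gcongr
    _ = _ := by ring

/-! ### Convolution on the circle -/

/-- The integral `∫_{-π}^{π} J(t) f(x + t) dt`. -/
def circleConv (J f : ℝ → ℂ) (x : ℝ) : ℂ := ∫ t in (-Real.pi)..Real.pi, J t * f (x + t)

lemma intervalIntegrable_comp_add {f : ℝ → ℂ} (hf : ∀ a b, IntervalIntegrable f volume a b)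
    (x a b : ℝ) : IntervalIntegrable (fun t => f (x + t)) volume a b := by
  have := (hf (a + x) (b + x)).comp_add_left x
  simpa using this

/-- For a character kernel, substituting `t ↦ x + t` factors out `expChar (-k) x`; by periodicity
the remaining integral does not depend on `x`. -/
lemma circleConv_mem_trigPoly {J f : ℝ → ℂ} {d : ℕ} (hJ : J ∈ trigPoly d)
    (hf : ∀ a b, IntervalIntegrable f volume a b) (hp : Function.Periodic f (2 * Real.pi)) :
    circleConv J f ∈ trigPoly d := by
  obtain ⟨c, rfl⟩ := exists_coeff_of_mem_trigPoly hJ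
  have hk : ∀ k : ℤ, ∀ x, ∫ t in (-Real.pi)..Real.pi, expChar k t * f (x + t)
      = (∫ t in (-Real.pi)..Real.pi, expChar k t * f t) * expChar (-k) x := by
    intro k x
    have h1 : ∀ t, expChar k t * f (x + t) = expChar (-k) x * (expChar k (x + t) * f (x + t)) := by
      intro t
      have : expChar (-k) x * expChar k x = 1 := by rw [← expChar_add]; simp
      rw [expChar_add_right]
      linear_combination (-expChar k t * f (x + t)) * this
    simp only [h1]
    rw [intervalIntegral.integral_const_mul, mul_comm,
      intervalIntegral.integral_comp_add_left (fun t => expChar k t * f t) x]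
    congr 1
    have hper : Function.Periodic (fun t => expChar k t * f t) (2 * Real.pi) :=
      (periodic_expChar k).mul hp
    have := hper.intervalIntegral_add_eq (x + -Real.pi) (-Real.pi)
    rwa [show x + -Real.pi + 2 * Real.pi = x + Real.pi by ring,
      show -Real.pi + 2 * Real.pi = Real.pi by ring] at this
  have e : circleConv (∑ k ∈ Finset.Icc (-(d : ℤ)) d, c k • expChar k) f
      = ∑ k ∈ Finset.Icc (-(d : ℤ)) d,
        (c k * ∫ t in (-Real.pi)..Real.pi, expChar k t * f t) • expChar (-k) := by
    ext x
    simp only [circleConv, Finset.sum_apply, Pi.smul_apply, smul_eq_mul, Finset.sum_mul, mul_assoc]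
    rw [intervalIntegral.integral_finsetSum fun k _ =>
      ((intervalIntegrable_comp_add hf x _ _).continuousOn_mul
        (continuous_expChar k).continuousOn).const_mul _]
    refine Finset.sum_congr rfl fun k _ => ?_
    rw [intervalIntegral.integral_const_mul, hk]
  rw [e]
  refine mem_trigPolySubmodule.1 (sum_mem fun k hk => Submodule.smul_mem _ _
    (expChar_mem_trigPoly ?_))
  rw [abs_neg]
  exact abs_le.2 (Finset.mem_Icc.1 hk)

lemma circleConv_jackson_eq_self (β : ℕ) {q : ℕ} {T : ℝ → ℂ} (hT : T ∈ trigPoly q) :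
    circleConv (jackson β q) T = T := by
  have hc := continuous_of_mem_trigPoly (jackson_mem_trigPoly β q)
  obtain ⟨c, rfl⟩ := exists_coeff_of_mem_trigPoly hT
  ext x
  simp only [circleConv, Finset.sum_apply, Pi.smul_apply, smul_eq_mul, Finset.mul_sum]
  rw [intervalIntegral.integral_finsetSum fun k _ =>
    (Continuous.intervalIntegrable (by fun_prop) _ _)]
  refine Finset.sum_congr rfl fun k hk => ?_
  have e : ∀ t, jackson β q t * (c k * expChar k (x + t))
      = c k * expChar k x * (jackson β q t * expChar k t) := fun t => by
    rw [expChar_add_right]; ring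
  simp only [e]
  rw [intervalIntegral.integral_const_mul,
    integral_jackson_mul_expChar β q (abs_le.2 (Finset.mem_Icc.1 hk)), mul_one]

/-- Fubini's theorem. Joint integrability of `J t * f (t + u)` comes from truncating both factors
and applying the shear `(t, u) ↦ (t, t + u)`, which preserves measure. -/
lemma circleConv_steklovDot {J f : ℝ → ℂ} (hJ : Continuous J)
    (hf : ∀ a b, IntervalIntegrable f volume a b) {h : ℝ} (hh : 0 < h) :
    circleConv J (steklovDot h f) = steklovDot h (circleConv J f) := by
  ext x
  have e1 : ∀ t, J t * steklovDot h f (x + t)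
      = (h : ℂ)⁻¹ * ∫ u in x..(x + h), J t * f (t + u) := fun t => by
    rw [steklovDot_eq, intervalIntegral.integral_const_mul,
      intervalIntegral.integral_comp_add_left f t, show x + t + h = t + (x + h) by ring,
      add_comm x t]
    ring
  simp only [circleConv, steklovDot_eq (f := circleConv J f), e1]
  rw [intervalIntegral.integral_const_mul]
  congr 1
  rw [intervalIntegral_intervalIntegral_swap]
  · simp only [add_comm]
  · set J1 := (Set.uIoc (-Real.pi) Real.pi).indicator J with hJ1
    set I := Set.Ioc (x - Real.pi) (x + h + Real.pi) with hI
    have hpi := Real.pi_pos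
    have hJ1i : Integrable J1 volume := by
      rw [hJ1, integrable_indicator_iff measurableSet_uIoc, ← intervalIntegrable_iff]
      exact hJ.intervalIntegrable _ _
    have hfi : Integrable (I.indicator f) volume := by
      rw [integrable_indicator_iff measurableSet_Ioc,
        ← intervalIntegrable_iff_integrableOn_Ioc_of_le (by linarith)]
      exact hf _ _
    have h2 := (measurePreserving_prod_add (volume : Measure ℝ) volume).integrable_comp_of_integrable
      (hJ1i.mul_prod hfi)
    have h3 := h2.restrict (s := Set.uIoc (-Real.pi) Real.pi ×ˢ Set.uIoc x (x + h))
    rw [IntegrableOn, Measure.volume_eq_prod]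
    refine h3.congr ?_
    filter_upwards [ae_restrict_mem (measurableSet_uIoc.prod measurableSet_uIoc)] with z hz
    obtain ⟨hz1, hz2⟩ := hz
    have hz3 : z.1 + z.2 ∈ I := by
      rw [Set.uIoc_of_le (by linarith)] at hz1 hz2
      exact ⟨by linarith [hz1.1, hz2.1], by linarith [hz1.2, hz2.2]⟩
    simp only [Function.comp, hJ1, Set.indicator_of_mem hz1, Set.indicator_of_mem hz3,
      Function.uncurry]

/-! ### First-order Jackson and Boas estimates -/

/-- The size of the rescaled kernels `jackson` and `jacksonDeriv`. -/
def kernelSize (γ : ℝ) : ℝ := 7 * γ + 135 * Real.pi ^ 3 / γ ^ 3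

lemma kernelSize_pos {γ : ℝ} (hγ : 0 < γ) : 0 < kernelSize γ := by
  have := Real.pi_pos
  unfold kernelSize; positivity

lemma le_kernelSize_div {γ : ℝ} (hγ : 0 < γ) {n : ℕ} (hn : 1 ≤ n) :
    7 * n ≤ kernelSize γ / (γ / n) := by
  have hn' : (0 : ℝ) < n := by exact_mod_cast hn
  have := Real.pi_pos
  rw [le_div_iff₀ (by positivity), kernelSize]
  have : 7 * (n : ℝ) * (γ / n) = 7 * γ := by field_simp
  rw [this]
  have : 0 < 135 * Real.pi ^ 3 / γ ^ 3 := by positivity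
  linarith

lemma le_kernelSize_mul {γ : ℝ} (hγ : 0 < γ) {n : ℕ} (hn : 1 ≤ n) :
    135 * Real.pi ^ 3 / n ^ 3 ≤ kernelSize γ * (γ / n) ^ 3 := by
  have hn' : (0 : ℝ) < n := by exact_mod_cast hn
  have := Real.pi_pos
  have e : kernelSize γ * (γ / n) ^ 3 = 7 * γ * (γ / n) ^ 3 + 135 * Real.pi ^ 3 / n ^ 3 := by
    rw [kernelSize]; field_simp
  rw [e]
  have : 0 < 7 * γ * (γ / n) ^ 3 := by positivity
  linarith

/-- The choice `β = ⌊n/3⌋` keeps `3β ≤ n` and still has `β + 1 ≥ n/3`, so the kernel decays at the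
scale `1/n`. -/
lemma inv_cube_le (n : ℕ) (hn : 1 ≤ n) :
    (2 * Real.pi * ((n / 3 : ℕ) + 1 : ℝ) ^ 3)⁻¹ * Real.pi ^ 4 ≤ 27 / 2 * Real.pi ^ 3 / n ^ 3 := by
  have hn' : (0 : ℝ) < n := by exact_mod_cast hn
  have hpi := Real.pi_pos
  have h1 : (n : ℝ) ≤ 3 * ((n / 3 : ℕ) + 1) := by
    have : n ≤ 3 * (n / 3 + 1) := by omega
    exact_mod_cast this
  have h2 : (n : ℝ) ^ 3 ≤ (3 * ((n / 3 : ℕ) + 1)) ^ 3 := pow_le_pow_left₀ hn'.le h1 3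
  have h3 : (2 * Real.pi * ((n / 3 : ℕ) + 1 : ℝ) ^ 3)⁻¹ * Real.pi ^ 4
      = 27 / 2 * Real.pi ^ 3 / (3 * ((n / 3 : ℕ) + 1)) ^ 3 := by field_simp; norm_num
  rw [h3]
  exact div_le_div_of_nonneg_left (by positivity) (by positivity) h2

namespace PeriodicBanachLattice

variable {X : PeriodicBanachLattice} {M : ℝ≥0}
  (hM : ∀ h : ℝ, 0 < h → ∀ f, X.Mem f → X.norm (steklov h f) ≤ M * X.norm f)
include hM

/-- The kernel has mean 1, so the error is an integral of increments of `f` and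
`Mem.nrm_kernel_integral_le` applies. Only the constants need to be reproduced, hence `q = 0`. -/
lemma nrm_sub_circleConv_le {γ : ℝ} (hγ : 0 < γ) {n : ℕ} (hn : 1 ≤ n) {f : ℝ → ℂ}
    (hf : X.Mem f) : X.nrm (f - circleConv (jackson (n / 3) 0) f)
      ≤ 64 * kernelSize γ * (481 * M + 1) * X.nrm (f - steklovDot (γ / n) f) := by
  have hn' : (1 : ℝ) ≤ n := by exact_mod_cast hn
  have hJ := jackson_mem_trigPoly (n / 3) 0
  have hc := continuous_of_mem_trigPoly hJ
  have hV := mem_of_mem_trigPoly (X := X) (circleConv_mem_trigPoly hJ hf.intervalIntegrable hf.per)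
  have hmem := hV.sub hf
  have hβ : (3 : ℝ) * (n / 3 : ℕ) ≤ n := by
    have : 3 * (n / 3) ≤ n := by omega
    exact_mod_cast this
  have hpi := Real.pi_gt_three
  rw [nrm_sub_comm]
  refine hf.nrm_kernel_integral_le hM (by positivity) (kernelSize_pos hγ).le
    (J := jackson (n / 3) 0) (fun t _ => ?_) (fun t ht => ?_) (fun x => ?_) hmem.measurable hmem.per
  · refine (norm_jackson_le _ _ t).trans (le_trans ?_ (le_kernelSize_div hγ hn))
    have e : (2 * Real.pi * ((n / 3 : ℕ) + 1 : ℝ) ^ 3)⁻¹ *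
        ((3 * (n / 3 : ℕ) + 2 * (0 : ℕ) + 1) * ((n / 3 : ℕ) + 1) ^ 3)
        = (3 * (n / 3 : ℕ) + 1) / (2 * Real.pi) := by field_simp; simp
    rw [e, div_le_iff₀ (by positivity)]
    nlinarith
  · refine (norm_jackson_mul_pow_le _ _ ht).trans ((inv_cube_le n hn).trans
      (le_trans ?_ (le_kernelSize_mul hγ hn)))
    gcongr
    norm_num
  · have h1 := integral_jackson_mul_expChar (n / 3) 0 (k := 0) (by simp)
    simp only [expChar_zero, mul_one] at h1
    simp only [mul_sub, Pi.sub_apply]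
    rw [intervalIntegral.integral_sub, intervalIntegral.integral_mul_const, h1, one_mul]
    · rfl
    · exact (intervalIntegrable_comp_add hf.intervalIntegrable x _ _).continuousOn_mul
        hc.continuousOn
    · exact Continuous.intervalIntegrable (by fun_prop) _ _

/-- With `q = n` the kernel reproduces `T'`. Integration by parts moves the derivative to the
kernel, and since the differentiated kernel has mean 0, `T(x+t)` may be replaced by `T(x+t) - T(x)`.
The factor `1/n` restores the kernel to height of order `n`. -/
lemma nrm_deriv_le {γ : ℝ} (hγ : 0 < γ) {n : ℕ} (hn : 1 ≤ n) {T : ℝ → ℂ}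
    (hT : T ∈ trigPoly n) : (1 / n : ℝ) * X.nrm (deriv T)
      ≤ 64 * kernelSize γ * (481 * M + 1) * X.nrm (T - steklovDot (γ / n) T) := by
  have hn' : (1 : ℝ) ≤ n := by exact_mod_cast hn
  have hn0 : (0 : ℝ) < n := by linarith
  have hβ : (3 : ℝ) * (n / 3 : ℕ) ≤ n := by
    have : 3 * (n / 3) ≤ n := by omega
    exact_mod_cast this
  have hβ0 : (0 : ℝ) ≤ (n / 3 : ℕ) := by positivity
  have hpi := Real.pi_gt_three
  have hT' := deriv_mem_trigPoly hT
  have hTm := mem_of_mem_trigPoly (X := X) hT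
  have hT'm := mem_of_mem_trigPoly (X := X) hT'
  set β := n / 3
  have hJc := continuous_of_mem_trigPoly (jackson_mem_trigPoly β n)
  have hJ'c : Continuous (jacksonDeriv β n) := by
    have h1 : ∀ a, Continuous (dirSum a) := fun a =>
      continuous_iff_continuousAt.2 fun x => (hasDerivAt_dirSum a x).continuousAt
    have h2 : ∀ a, Continuous (dirSumDeriv a) := fun a => by unfold dirSumDeriv; fun_prop
    have h1a := h1 (3 * β + 2 * n + 1)
    have h1b := h1 (β + 1)
    have h2a := h2 (3 * β + 2 * n + 1)
    have h2b := h2 (β + 1)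
    unfold jacksonDeriv
    fun_prop
  have hTc := continuous_of_mem_trigPoly hT
  have hTc' := continuous_of_mem_trigPoly hT'
  have hdiff := differentiable_of_mem_trigPoly hT
  have hJper := periodic_of_mem_trigPoly (jackson_mem_trigPoly β n) (-Real.pi)
  rw [show -Real.pi + 2 * Real.pi = Real.pi by ring] at hJper
  have hrep : ∀ x, deriv T x = -∫ t in (-Real.pi)..Real.pi, jacksonDeriv β n t * T (x + t) := by
    intro x
    have h1 := congrFun (circleConv_jackson_eq_self β hT') x
    rw [circleConv, intervalIntegral.integral_mul_deriv_eq_deriv_mul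
      (u := jackson β n) (v := fun t => T (x + t)) (u' := jacksonDeriv β n)
      (fun t _ => hasDerivAt_jackson β n t)
      (fun t _ => by simpa using (hdiff (x + t)).hasDerivAt.comp_const_add x t)
      (hJ'c.intervalIntegrable _ _) (Continuous.intervalIntegrable (by fun_prop) _ _)] at h1
    have hTper := periodic_of_mem_trigPoly hT (x + -Real.pi)
    rw [show x + -Real.pi + 2 * Real.pi = x + Real.pi by ring] at hTper
    rw [← h1, hJper, hTper]
    ring
  have hint0 : ∫ t in (-Real.pi)..Real.pi, jacksonDeriv β n t = 0 := by
    rw [intervalIntegral.integral_eq_sub_of_hasDerivAt (fun t _ => hasDerivAt_jackson β n t)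
      (hJ'c.intervalIntegrable _ _), hJper, sub_self]
  have e0 : (1 / n : ℝ) * X.nrm (deriv T) = X.nrm ((-(1 / n : ℂ)) • (-deriv T)) := by
    rw [nrm_smul, nrm_neg]; simp
  rw [e0]
  have hmem : X.Mem ((-(1 / n : ℂ)) • (-deriv T)) := hT'm.neg.smul _
  have hscale : ∀ t, ‖-(1 / n : ℂ) * jacksonDeriv β n t‖ = 1 / n * ‖jacksonDeriv β n t‖ := by
    intro t; simp
  refine hTm.nrm_kernel_integral_le hM (by positivity) (kernelSize_pos hγ).le
    (J := fun t => -(1 / n : ℂ) * jacksonDeriv β n t) (fun t _ => ?_) (fun t ht => ?_)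
    (fun x => ?_) hmem.measurable hmem.per
  · rw [hscale]
    refine le_trans ?_ (le_kernelSize_div hγ hn)
    have h1 := norm_jacksonDeriv_le β n t
    have e : (2 * Real.pi * ((β : ℝ) + 1) ^ 3)⁻¹ * ((3 * β + 2 * n + 1) * (β + 1) ^ 3 *
        ((3 * β + n) + (3 * β + 2 * n + 1) + 3 * (β + 1)))
        = (3 * β + 2 * n + 1) * ((3 * β + n) + (3 * β + 2 * n + 1) + 3 * (β + 1))
          / (2 * Real.pi) := by field_simp
    rw [e] at h1
    have h2 : (3 * β + 2 * n + 1 : ℝ) * ((3 * β + n) + (3 * β + 2 * n + 1) + 3 * (β + 1))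
        ≤ (4 * n) * (10 * n) := by
      gcongr <;> linarith
    rw [one_div, inv_mul_le_iff₀ hn0]
    refine h1.trans ((div_le_iff₀ (by positivity)).2 (h2.trans ?_))
    nlinarith [sq_nonneg (n : ℝ)]
  · rw [hscale, mul_assoc]
    refine le_trans ?_ (le_kernelSize_mul hγ hn)
    have h1 := norm_jacksonDeriv_mul_pow_le β n ht
    have h2 : (3 * β + n : ℝ) + (3 * β + 2 * n + 1) + 3 * (β + 1) ≤ 10 * n := by linarith
    have h3 := inv_cube_le n hn
    rw [one_div, inv_mul_le_iff₀ hn0]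
    calc _ ≤ _ := h1
      _ ≤ (2 * Real.pi * ((β : ℝ) + 1) ^ 3)⁻¹ * (Real.pi ^ 4 * (10 * n)) := by gcongr
      _ = ((2 * Real.pi * ((β : ℝ) + 1) ^ 3)⁻¹ * Real.pi ^ 4) * (10 * n) := by ring
      _ ≤ 27 / 2 * Real.pi ^ 3 / n ^ 3 * (10 * n) := by gcongr
      _ = _ := by ring
  · simp only [mul_sub, mul_assoc, Pi.smul_apply, Pi.neg_apply, smul_eq_mul]
    rw [intervalIntegral.integral_sub, intervalIntegral.integral_const_mul,
      intervalIntegral.integral_const_mul, intervalIntegral.integral_mul_const, hint0, hrep]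
    · ring
    · exact Continuous.intervalIntegrable (by fun_prop) _ _
    · exact Continuous.intervalIntegrable (by fun_prop) _ _

end PeriodicBanachLattice

/-! ### Powers of `I - A` and their action on polynomials -/

lemma diffPow_zero (A : (ℝ → ℂ) → ℝ → ℂ) (f : ℝ → ℂ) : diffPow A 0 f = f := rfl

lemma diffPow_succ (A : (ℝ → ℂ) → ℝ → ℂ) (r : ℕ) (f : ℝ → ℂ) :
    diffPow A (r + 1) f = diffPow A r (f - A f) := rfl

lemma diffPow_succ' (A : (ℝ → ℂ) → ℝ → ℂ) (r : ℕ) (f : ℝ → ℂ) :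
    diffPow A (r + 1) f = diffPow A r f - A (diffPow A r f) :=
  Function.iterate_succ_apply' _ _ _

lemma steklov_sub {f g : ℝ → ℂ} (hf : ∀ a b, IntervalIntegrable f volume a b)
    (hg : ∀ a b, IntervalIntegrable g volume a b) (h : ℝ) :
    steklov h (f - g) = steklov h f - steklov h g := by
  ext x
  simp only [steklov, Pi.sub_apply]
  rw [intervalIntegral.integral_sub (hf _ _) (hg _ _), mul_sub]

lemma steklovDot_sub {f g : ℝ → ℂ} (hf : ∀ a b, IntervalIntegrable f volume a b)
    (hg : ∀ a b, IntervalIntegrable g volume a b) (h : ℝ) :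
    steklovDot h (f - g) = steklovDot h f - steklovDot h g := by
  ext x
  simp only [steklovDot, steklov_sub hf hg, Pi.sub_apply]

lemma circleConv_sub {J f g : ℝ → ℂ} (hJ : Continuous J)
    (hf : ∀ a b, IntervalIntegrable f volume a b)
    (hg : ∀ a b, IntervalIntegrable g volume a b) :
    circleConv J (f - g) = circleConv J f - circleConv J g := by
  ext x
  simp only [circleConv, Pi.sub_apply, mul_sub]
  exact intervalIntegral.integral_sub
    ((intervalIntegrable_comp_add hf x _ _).continuousOn_mul hJ.continuousOn)
    ((intervalIntegrable_comp_add hg x _ _).continuousOn_mul hJ.continuousOn)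

/-- An operator acts diagonally on the characters. -/
def IsFourierMultiplier (A : (ℝ → ℂ) → ℝ → ℂ) : Prop :=
  ∃ a : ℤ → ℂ, ∀ (s : Finset ℤ) (c : ℤ → ℂ),
    A (∑ k ∈ s, c k • expChar k) = ∑ k ∈ s, (c k * a k) • expChar k

lemma isFourierMultiplier_steklov (h : ℝ) : IsFourierMultiplier (steklov h) := by
  refine ⟨fun k => (h : ℂ)⁻¹ * ∫ t in (-(h / 2))..(h / 2), expChar k t, fun s c => ?_⟩
  ext x
  simp only [steklov, Finset.sum_apply, Pi.smul_apply, smul_eq_mul]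
  rw [intervalIntegral.integral_finsetSum fun k _ =>
    (Continuous.intervalIntegrable (by fun_prop) _ _), Finset.mul_sum]
  refine Finset.sum_congr rfl fun k _ => ?_
  have : ∫ t in (x - h / 2)..(x + h / 2), expChar k t
      = expChar k x * ∫ t in (-(h / 2))..(h / 2), expChar k t := by
    rw [← intervalIntegral.integral_const_mul]
    simp only [← expChar_add_right]
    rw [intervalIntegral.integral_comp_add_left (fun t => expChar k t) x, ← sub_eq_add_neg]
  rw [intervalIntegral.integral_const_mul, this]
  ring

lemma isFourierMultiplier_steklovDot (h : ℝ) : IsFourierMultiplier (steklovDot h) := by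
  obtain ⟨a, ha⟩ := isFourierMultiplier_steklov h
  refine ⟨fun k => a k * expChar k (h / 2), fun s c => ?_⟩
  ext x
  simp only [steklovDot, ha, Finset.sum_apply, Pi.smul_apply, smul_eq_mul, expChar_add_right]
  exact Finset.sum_congr rfl fun k _ => by ring

namespace IsFourierMultiplier

variable {A : (ℝ → ℂ) → ℝ → ℂ} (hA : IsFourierMultiplier A)
include hA

lemma diffPow (r : ℕ) : IsFourierMultiplier (diffPow A r) := by
  obtain ⟨a, ha⟩ := hA
  refine ⟨fun k => (1 - a k) ^ r, fun s c => ?_⟩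
  induction r with
  | zero => simp [diffPow_zero]
  | succ r ih =>
    rw [diffPow_succ', ih, ha, ← Finset.sum_sub_distrib]
    refine Finset.sum_congr rfl fun k _ => ?_
    rw [← sub_smul]
    congr 1; ring

variable {n : ℕ} {T : ℝ → ℂ} (hT : T ∈ trigPoly n)
include hT

lemma mem_trigPoly : A T ∈ trigPoly n := by
  obtain ⟨a, ha⟩ := hA
  obtain ⟨c, rfl⟩ := exists_coeff_of_mem_trigPoly hT
  rw [ha]
  exact mem_trigPolySubmodule.1 (sum_mem fun k hk => Submodule.smul_mem _ _
    (expChar_mem_trigPoly (abs_le.2 (Finset.mem_Icc.1 hk))))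

lemma deriv_apply : deriv (A T) = A (deriv T) := by
  obtain ⟨a, ha⟩ := hA
  obtain ⟨c, rfl⟩ := exists_coeff_of_mem_trigPoly hT
  rw [ha, deriv_sum_expChar, deriv_sum_expChar]
  simp only [smul_smul, ha]
  exact Finset.sum_congr rfl fun k _ => by congr 1; ring

lemma iteratedDeriv_apply (j : ℕ) : iteratedDeriv j (A T) = A (iteratedDeriv j T) := by
  induction j with
  | zero => simp
  | succ j ih =>
    rw [iteratedDeriv_succ, ih, hA.deriv_apply (iteratedDeriv_mem_trigPoly hT j),
      ← iteratedDeriv_succ]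

end IsFourierMultiplier

namespace PeriodicBanachLattice

variable {X : PeriodicBanachLattice}

section DiffPow

variable {A : (ℝ → ℂ) → ℝ → ℂ} {K : ℝ}
  (hA : ∀ f, X.Mem f → X.Mem (A f) ∧ X.nrm (A f) ≤ K * X.nrm f)

include hA in
lemma mem_diffPow (hK : 0 ≤ K) (r : ℕ) {f : ℝ → ℂ} (hf : X.Mem f) :
    X.Mem (diffPow A r f) ∧ X.nrm (diffPow A r f) ≤ (1 + K) ^ r * X.nrm f := by
  induction r with
  | zero => simpa [diffPow_zero] using hf
  | succ r ih =>
    rw [diffPow_succ']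
    obtain ⟨h1, h2⟩ := ih
    obtain ⟨h3, h4⟩ := hA _ h1
    refine ⟨h1.sub h3, (nrm_sub_le h1 h3).trans ?_⟩
    calc _ ≤ (1 + K) * X.nrm (diffPow A r f) := by linarith
      _ ≤ (1 + K) * ((1 + K) ^ r * X.nrm f) := by gcongr
      _ = _ := by ring

include hA in
lemma diffPow_sub (hsub : ∀ f g, X.Mem f → X.Mem g → A (f - g) = A f - A g) (r : ℕ)
    {f g : ℝ → ℂ} (hf : X.Mem f) (hg : X.Mem g) :
    diffPow A r (f - g) = diffPow A r f - diffPow A r g := by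
  induction r generalizing f g with
  | zero => rfl
  | succ r ih =>
    rw [diffPow_succ, diffPow_succ, diffPow_succ, ← ih (hf.sub (hA f hf).1) (hg.sub (hA g hg).1),
      hsub f g hf hg]
    congr 1; abel

end DiffPow

/-- If `I - A` is controlled on trigonometric polynomials by the `p`-th derivative, then
`(I - A)^r` is controlled by the derivative of order `pr`. -/
lemma nrm_diffPow_le_iteratedDeriv {A : (ℝ → ℂ) → ℝ → ℂ} (hA : IsFourierMultiplier A) {n p : ℕ}
    {c : ℝ} (hc : 0 ≤ c)
    (h : ∀ T ∈ trigPoly n, X.nrm (T - A T) ≤ c * X.nrm (iteratedDeriv p T)) (r : ℕ) {T : ℝ → ℂ}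
    (hT : T ∈ trigPoly n) : X.nrm (diffPow A r T) ≤ c ^ r * X.nrm (iteratedDeriv (p * r) T) := by
  induction r generalizing T with
  | zero => simp [diffPow_zero]
  | succ r ih =>
    have h1 := (hA.diffPow 1).mem_trigPoly hT
    have h2 := (hA.diffPow 1).iteratedDeriv_apply hT (p * r)
    simp only [diffPow_succ, diffPow_zero] at h1 h2 ⊢
    have e : iteratedDeriv p (iteratedDeriv (p * r) T) = iteratedDeriv (p * (r + 1)) T := by
      simp only [iteratedDeriv_eq_iterate, ← Function.iterate_add_apply]
      rw [mul_add, mul_one, add_comm]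
    calc _ ≤ _ := ih h1
      _ ≤ c ^ r * (c * X.nrm (iteratedDeriv (p * (r + 1)) T)) := by
        rw [h2, ← e]
        exact mul_le_mul_of_nonneg_left (h _ (iteratedDeriv_mem_trigPoly hT _)) (by positivity)
      _ = _ := by ring

variable {M : ℝ≥0}
  (hM : ∀ h : ℝ, 0 < h → ∀ f, X.Mem f → X.norm (steklov h f) ≤ M * X.norm f)
include hM

lemma nrm_sub_steklovDot_le {n : ℕ} {T : ℝ → ℂ} (hT : T ∈ trigPoly n) {h : ℝ} (hh : 0 < h) :
    X.nrm (T - steklovDot h T) ≤ 2 * h * M * X.nrm (iteratedDeriv 1 T) := by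
  have hT' := deriv_mem_trigPoly hT
  have hTm := mem_of_mem_trigPoly (X := X) hT
  have hT'm := mem_of_mem_trigPoly (X := X) hT'
  have hTc := continuous_of_mem_trigPoly hT
  have hmem := hTm.sub (mem_steklovDot hM hTm hh).1
  rw [iteratedDeriv_one]
  refine ((hT'm.bdd_local hM hh).bound hmem.measurable hmem.per fun x => ?_).2.trans
    (le_of_eq (by ring))
  set B := ∫ t in (x - h)..(x + h), ‖deriv T t‖
  have h1 : ‖∫ t in x..(x + h), (T x - T t)‖ ≤ B * |x + h - x| :=
    intervalIntegral.norm_integral_le_of_norm_le_const fun t ht => by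
      rw [Set.uIoc_of_le (by linarith)] at ht
      rw [norm_sub_rev, ← integral_deriv_of_mem_trigPoly hT]
      exact norm_integral_le_of_subset hT'm.intervalIntegrable (by linarith) ht.1.le ht.2
  rw [add_sub_cancel_left, abs_of_pos hh] at h1
  have h2 : (T - steklovDot h T) x = (h : ℂ)⁻¹ * ∫ t in x..(x + h), (T x - T t) := by
    have : (h : ℂ) ≠ 0 := by exact_mod_cast hh.ne'
    rw [intervalIntegral.integral_sub intervalIntegrable_const (hTc.intervalIntegrable _ _),
      Pi.sub_apply, steklovDot_eq, intervalIntegral.integral_const, add_sub_cancel_left,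
      Complex.real_smul]
    field_simp
  rw [h2, norm_mul, norm_inv, Complex.norm_of_nonneg hh.le, inv_mul_le_iff₀ hh]
  linarith

/-- The average is centred, so the linear Taylor term integrates to zero and a second derivative is
gained. This is where each factor `I - A_h` earns order 2, against order 1 for `I - Ȧ_h`. -/
lemma nrm_sub_steklov_le {n : ℕ} {T : ℝ → ℂ} (hT : T ∈ trigPoly n) {h : ℝ} (hh : 0 < h) :
    X.nrm (T - steklov h T) ≤ h ^ 2 / 2 * M * X.nrm (iteratedDeriv 2 T) := by
  have hT' := deriv_mem_trigPoly hT
  have hT'' := deriv_mem_trigPoly hT'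
  have hTm := mem_of_mem_trigPoly (X := X) hT
  have hT''m := mem_of_mem_trigPoly (X := X) hT''
  have hTc := continuous_of_mem_trigPoly hT
  have hdiff := differentiable_of_mem_trigPoly hT
  have hmem := hTm.sub (mem_steklov hM hTm hh).1
  rw [iteratedDeriv_succ, iteratedDeriv_one]
  have hh2 : 0 < h / 2 := by linarith
  refine (((hT''m.bdd_local hM hh2).const_mul hh2.le).bound hmem.measurable hmem.per
    fun x => ?_).2.trans (le_of_eq (by ring))
  set B := ∫ t in (x - h / 2)..(x + h / 2), ‖deriv (deriv T) t‖
  have hd : ∀ t ∈ Set.Icc (-(h / 2)) (h / 2), ‖deriv T (x + t) - deriv T x‖ ≤ B := by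
    intro t ht
    rw [← integral_deriv_of_mem_trigPoly hT']
    rcases le_total 0 t with h0 | h0
    · exact norm_integral_le_of_subset hT''m.intervalIntegrable (by linarith) (by linarith)
        (by linarith [ht.2])
    · rw [intervalIntegral.integral_symm, norm_neg]
      exact norm_integral_le_of_subset hT''m.intervalIntegrable (by linarith [ht.1])
        (by linarith) (by linarith)
  have hR : ∀ t ∈ Set.Icc (-(h / 2)) (h / 2), ‖T (x + t) - T x - t * deriv T x‖ ≤ B * (h / 2) := by
    intro t ht
    have h1 := (convex_Icc (-(h / 2)) (h / 2)).norm_image_sub_le_of_norm_hasDerivWithin_le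
      (f := fun t : ℝ => T (x + t) - t * deriv T x) (f' := fun t => deriv T (x + t) - deriv T x)
      (C := B) (x := 0) (y := t) (fun y _ => by
        have e1 : HasDerivAt (fun t => T (x + t)) (deriv T (x + y)) y :=
          (hdiff (x + y)).hasDerivAt.comp_const_add x y
        have e2 : HasDerivAt (fun t : ℝ => (t : ℂ) * deriv T x) (1 * deriv T x) y :=
          (Complex.ofRealCLM.hasDerivAt (x := y)).mul_const _
        have e3 := (e1.sub e2).hasDerivWithinAt (s := Set.Icc (-(h / 2)) (h / 2))
        rw [one_mul] at e3
        exact e3) hd ⟨by linarith, by linarith⟩ ht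
    have hB0 : 0 ≤ B := (norm_nonneg _).trans (hd 0 ⟨by linarith, by linarith⟩)
    have h2 : ‖t - 0‖ ≤ h / 2 := by
      rw [sub_zero, Real.norm_eq_abs]; exact abs_le.2 ht
    have h3 : T (x + t) - T x - t * deriv T x
        = T (x + t) - t * deriv T x - (T (x + 0) - ((0 : ℝ) : ℂ) * deriv T x) := by
      simp; ring
    rw [h3]
    exact h1.trans (mul_le_mul_of_nonneg_left h2 hB0)
  have h1 : ‖∫ t in (-(h / 2))..(h / 2), (T (x + t) - T x - t * deriv T x)‖
      ≤ B * (h / 2) * |h / 2 - -(h / 2)| :=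
    intervalIntegral.norm_integral_le_of_norm_le_const fun t ht => by
      rw [Set.uIoc_of_le (by linarith)] at ht
      exact hR t ⟨ht.1.le, ht.2⟩
  rw [sub_neg_eq_add, add_halves, abs_of_pos hh] at h1
  have h2 : (T - steklov h T) x
      = -((h : ℂ)⁻¹ * ∫ t in (-(h / 2))..(h / 2), (T (x + t) - T x - t * deriv T x)) := by
    have hne : (h : ℂ) ≠ 0 := by exact_mod_cast hh.ne'
    have hid : ∫ t in (-(h / 2))..(h / 2), ((t : ℝ) : ℂ) = 0 := by
      rw [intervalIntegral.integral_ofReal, integral_id]; simp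
    rw [intervalIntegral.integral_sub (Continuous.intervalIntegrable (by fun_prop) _ _)
        (Continuous.intervalIntegrable (by fun_prop) _ _),
      intervalIntegral.integral_sub (Continuous.intervalIntegrable (by fun_prop) _ _)
        intervalIntegrable_const, intervalIntegral.integral_mul_const, hid,
      intervalIntegral.integral_comp_add_left T x, intervalIntegral.integral_const,
      sub_neg_eq_add, add_halves, Complex.real_smul, Pi.sub_apply, steklov, ← sub_eq_add_neg]
    field_simp
    ring
  rw [h2, norm_neg, norm_mul, norm_inv, Complex.norm_of_nonneg hh.le, inv_mul_le_iff₀ hh]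
  linarith

end PeriodicBanachLattice

/-! ### The discrete semi-norm -/

lemma trigPoly_mono {n k : ℕ} (h : n ≤ k) {T : ℝ → ℂ} (hT : T ∈ trigPoly n) : T ∈ trigPoly k := by
  obtain ⟨c, rfl⟩ := exists_coeff_of_mem_trigPoly hT
  refine mem_trigPolySubmodule.1 (sum_mem fun l hl => Submodule.smul_mem _ _
    (expChar_mem_trigPoly ((abs_le.2 (Finset.mem_Icc.1 hl)).trans (by exact_mod_cast h))))

/-- The step function `∑_k |f(x_k)| χ_{[x_k, x_{k+1})}`. -/
def nodeStep (m : ℕ) (x : ℕ → ℝ) (f : ℝ → ℂ) (y : ℝ) : ℝ :=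
  ∑ k ∈ Finset.Icc 1 m, (arc (x k) (x (k + 1))).indicator (fun _ => ‖f (x k)‖) y

lemma measurableSet_arc (a b : ℝ) : MeasurableSet (arc a b) := by
  have : arc a b = ⋃ j : ℤ, (fun y : ℝ => y + j * (2 * Real.pi)) ⁻¹' Set.Ico a b := by
    ext y; simp only [arc, Set.mem_ofPred_eq, Set.mem_iUnion, Set.mem_preimage]
  rw [this]
  exact MeasurableSet.iUnion fun j => (by fun_prop : Measurable _) measurableSet_Ico

lemma add_two_pi_mem_arc (a b y : ℝ) : y + 2 * Real.pi ∈ arc a b ↔ y ∈ arc a b := by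
  constructor
  · rintro ⟨j, hj⟩
    refine ⟨j + 1, ?_⟩
    push_cast
    rwa [show y + (j + 1) * (2 * Real.pi) = y + 2 * Real.pi + j * (2 * Real.pi) by ring]
  · rintro ⟨j, hj⟩
    refine ⟨j - 1, ?_⟩
    push_cast
    rwa [show y + 2 * Real.pi + (j - 1) * (2 * Real.pi) = y + j * (2 * Real.pi) by ring]

lemma measurable_nodeStep (m : ℕ) (x : ℕ → ℝ) (f : ℝ → ℂ) : Measurable (nodeStep m x f) :=
  Finset.measurable_fun_sum _ fun _ _ => measurable_const.indicator (measurableSet_arc _ _)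

lemma periodic_nodeStep (m : ℕ) (x : ℕ → ℝ) (f : ℝ → ℂ) :
    Function.Periodic (nodeStep m x f) (2 * Real.pi) := by
  intro y
  refine Finset.sum_congr rfl fun k _ => ?_
  have e := add_two_pi_mem_arc (x k) (x (k + 1)) y
  by_cases h : y ∈ arc (x k) (x (k + 1))
  · rw [Set.indicator_of_mem h, Set.indicator_of_mem (e.2 h)]
  · rw [Set.indicator_of_notMem h, Set.indicator_of_notMem (mt e.1 h)]

lemma nodeStep_nonneg (m : ℕ) (x : ℕ → ℝ) (f : ℝ → ℂ) (y : ℝ) : 0 ≤ nodeStep m x f y :=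
  Finset.sum_nonneg fun _ _ => Set.indicator_nonneg (fun _ _ => norm_nonneg _) _

lemma nodeStep_sub_le (m : ℕ) (x : ℕ → ℝ) (f g : ℝ → ℂ) (y : ℝ) :
    nodeStep m x (f - g) y ≤ nodeStep m x f y + nodeStep m x g y := by
  simp only [nodeStep, ← Finset.sum_add_distrib]
  refine Finset.sum_le_sum fun k _ => ?_
  by_cases h : y ∈ arc (x k) (x (k + 1))
  · simp only [Set.indicator_of_mem h]
    exact norm_sub_le _ _
  · simp [Set.indicator_of_notMem h]

/-- The arcs of a node system are disjoint, so that `nodeStep` is a local majorant. -/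
lemma nodeStep_le {m : ℕ} {x : ℕ → ℝ} (hend : x (m + 1) = 2 * Real.pi + x 1)
    (hlt : ∀ k ∈ Finset.Icc 1 m, x k < x (k + 1)) {f : ℝ → ℂ} {Φ : ℝ → ℝ}
    (hper : Function.Periodic Φ (2 * Real.pi)) (h0 : ∀ y, 0 ≤ Φ y)
    (hΦ : ∀ k ∈ Finset.Icc 1 m, ∀ y ∈ Set.Ico (x k) (x (k + 1)), ‖f (x k)‖ ≤ Φ y) (y : ℝ) :
    nodeStep m x f y ≤ Φ y := by
  have hmono : ∀ k l, 1 ≤ k → k ≤ l → l ≤ m + 1 → x k ≤ x l := by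
    intro k l hk hkl
    induction l, hkl using Nat.le_induction with
    | base => intro _; exact le_rfl
    | succ l hl ih =>
      intro hlm
      exact (ih (by omega)).trans (hlt l (Finset.mem_Icc.2 ⟨by omega, by omega⟩)).le
  by_cases hex : ∃ k ∈ Finset.Icc 1 m, y ∈ arc (x k) (x (k + 1))
  · obtain ⟨k, hk, j, hj⟩ := hex
    have hk' := Finset.mem_Icc.1 hk
    rw [nodeStep, Finset.sum_eq_single k]
    · refine (Set.indicator_le_self' (fun _ _ => norm_nonneg _) y).trans ?_
      have := hΦ k hk _ hj
      rwa [hper.int_mul j y] at this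
    · intro l hl hlk
      refine Set.indicator_of_notMem ?_ _
      rintro ⟨i, hi⟩
      have hl' := Finset.mem_Icc.1 hl
      have b1 := hmono 1 k le_rfl hk'.1 (by omega)
      have b2 := hmono 1 l le_rfl hl'.1 (by omega)
      have b3 := hmono (k + 1) (m + 1) (by omega) (by omega) le_rfl
      have b4 := hmono (l + 1) (m + 1) (by omega) (by omega) le_rfl
      have hpi := Real.pi_pos
      -- Both translates of `y` lie in `[x 1, x 1 + 2π)`, so they coincide.
      have hij : i = j := by
        have c1 : ((i - j : ℤ) : ℝ) * (2 * Real.pi) < 1 * (2 * Real.pi) := by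
          push_cast; linarith [hi.1, hi.2, hj.1, hj.2]
        have c2 : (-1 : ℝ) * (2 * Real.pi) < ((i - j : ℤ) : ℝ) * (2 * Real.pi) := by
          push_cast; linarith [hi.1, hi.2, hj.1, hj.2]
        have d1 := lt_of_mul_lt_mul_right c1 (by positivity)
        have d2 := lt_of_mul_lt_mul_right c2 (by positivity)
        have d1' : i - j < 1 := by exact_mod_cast d1
        have d2' : -1 < i - j := by exact_mod_cast d2
        omega
      subst hij
      rcases lt_or_gt_of_ne hlk with h | h
      · have := hmono (l + 1) k (by omega) h (by omega)
        linarith [hi.2, hj.1]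
      · have := hmono (k + 1) l (by omega) h (by omega)
        linarith [hi.1, hj.2]
    · exact fun h => absurd hk h
  · push Not at hex
    rw [nodeStep, Finset.sum_eq_zero fun k hk => Set.indicator_of_notMem (hex k hk) _]
    exact h0 y

namespace PeriodicBanachLattice

variable {X : PeriodicBanachLattice}

lemma discreteNorm_eq (m : ℕ) (x : ℕ → ℝ) (f : ℝ → ℂ) :
    discreteNorm X m x f = X.norm fun y => (nodeStep m x f y : ℂ) := by
  rw [discreteNorm]
  congr 1
  ext y
  rw [nodeStep, Complex.ofReal_sum]
  refine Finset.sum_congr rfl fun k _ => ?_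
  by_cases h : y ∈ arc (x k) (x (k + 1)) <;> simp [h]

lemma mem_nodeStep (m : ℕ) (x : ℕ → ℝ) (f : ℝ → ℂ) :
    X.Mem fun y => (nodeStep m x f y : ℂ) := by
  refine mem_of_bounded
    (Complex.measurable_ofReal.comp (measurable_nodeStep m x f)).aestronglyMeasurable
    (fun y => by simp only [periodic_nodeStep m x f y]) (B := ∑ k ∈ Finset.Icc 1 m, ‖f (x k)‖)
    fun y => ?_
  rw [Complex.norm_of_nonneg (nodeStep_nonneg m x f y)]
  exact Finset.sum_le_sum fun k _ => Set.indicator_le_self' (fun _ _ => norm_nonneg _) y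

variable (X) in
/-- The discrete semi-norm as a real number. -/
def dnrm (m : ℕ) (x : ℕ → ℝ) (f : ℝ → ℂ) : ℝ := X.nrm fun y => (nodeStep m x f y : ℂ)

lemma discreteNorm_eq_ofReal (m : ℕ) (x : ℕ → ℝ) (f : ℝ → ℂ) :
    discreteNorm X m x f = ENNReal.ofReal (X.dnrm m x f) := by
  rw [discreteNorm_eq, (mem_nodeStep m x f).norm_eq, dnrm]

lemma dnrm_nonneg (m : ℕ) (x : ℕ → ℝ) (f : ℝ → ℂ) : 0 ≤ X.dnrm m x f := nrm_nonneg _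

lemma dnrm_le_of_bdd {m : ℕ} {x : ℕ → ℝ} {f : ℝ → ℂ} {Φ : ℝ → ℝ} {B : ℝ} (h : X.Bdd Φ B)
    (hle : ∀ y, nodeStep m x f y ≤ Φ y) : X.dnrm m x f ≤ B :=
  have hm := mem_nodeStep (X := X) m x f
  (h.bound hm.measurable hm.per fun y => by
    rw [Complex.norm_of_nonneg (nodeStep_nonneg m x f y)]; exact hle y).2

lemma dnrm_sub_le (m : ℕ) (x : ℕ → ℝ) (f g : ℝ → ℂ) :
    X.dnrm m x (f - g) ≤ X.dnrm m x f + X.dnrm m x g :=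
  dnrm_le_of_bdd (Bdd.add ⟨mem_nodeStep m x f, le_rfl⟩ ⟨mem_nodeStep m x g, le_rfl⟩)
    (nodeStep_sub_le m x f g)

lemma dnrm_sub_comm (m : ℕ) (x : ℕ → ℝ) (f g : ℝ → ℂ) :
    X.dnrm m x (f - g) = X.dnrm m x (g - f) := by
  simp only [dnrm, nodeStep, Pi.sub_apply, norm_sub_rev]

lemma dnrm_le_add_sub (m : ℕ) (x : ℕ → ℝ) (f g : ℝ → ℂ) :
    X.dnrm m x f ≤ X.dnrm m x g + X.dnrm m x (f - g) := by
  have := dnrm_sub_le (X := X) m x g (g - f)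
  rwa [sub_sub_cancel, dnrm_sub_comm m x g f] at this

lemma dnrm_le_of_local {m : ℕ} {x : ℕ → ℝ} (hend : x (m + 1) = 2 * Real.pi + x 1)
    (hlt : ∀ k ∈ Finset.Icc 1 m, x k < x (k + 1)) {f : ℝ → ℂ} {Φ : ℝ → ℝ} {B : ℝ}
    (h : X.Bdd Φ B) (h0 : ∀ y, 0 ≤ Φ y)
    (hΦ : ∀ k ∈ Finset.Icc 1 m, ∀ y ∈ Set.Ico (x k) (x (k + 1)), ‖f (x k)‖ ≤ Φ y) :
    X.dnrm m x f ≤ B :=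
  dnrm_le_of_bdd h (nodeStep_le hend hlt
    (fun y => Complex.ofReal_injective (h.1.per y)) h0 hΦ)

variable {M : ℝ≥0}
  (hM : ∀ h : ℝ, 0 < h → ∀ f, X.Mem f → X.norm (steklov h f) ≤ M * X.norm f)
include hM

section Nodes

variable {m : ℕ} {x : ℕ → ℝ} (hend : x (m + 1) = 2 * Real.pi + x 1) {δ : ℝ}
  (hlt : ∀ k ∈ Finset.Icc 1 m, x k < x (k + 1))
  (hgap : ∀ k ∈ Finset.Icc 1 m, x (k + 1) - x k ≤ δ) (hδ : 0 < δ)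
include hend hlt hgap hδ

/-- A node is within `δ` of each point of its arc, so its averaging window lies in the window of
radius `h/2 + δ` about that point. Thus samples of averages are controlled in `X`, although samples
of `f` are not. -/
lemma dnrm_steklov_le {f : ℝ → ℂ} (hf : X.Mem f) {h : ℝ} (hh : 0 < h) :
    X.dnrm m x (steklov h f) ≤ (1 + 2 * (δ / h)) * M * X.nrm f := by
  have ha : 0 < h / 2 + δ := by linarith
  refine (dnrm_le_of_local hend hlt
    ((hf.bdd_local hM ha).const_mul (inv_nonneg.2 hh.le)) (fun y => ?_) fun k hk y hy => ?_).trans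
    (le_of_eq ?_)
  · exact mul_nonneg (inv_nonneg.2 hh.le) (intervalIntegral.integral_nonneg (by linarith)
      fun _ _ => norm_nonneg _)
  · rw [steklov, norm_mul, norm_inv, Complex.norm_of_nonneg hh.le]
    have := hgap k hk
    exact mul_le_mul_of_nonneg_left (norm_integral_le_of_subset hf.intervalIntegrable
      (by linarith [hy.2]) (by linarith) (by linarith [hy.1])) (inv_nonneg.2 hh.le)
  · field_simp

lemma dnrm_trigPoly_le {n : ℕ} {T : ℝ → ℂ} (hT : T ∈ trigPoly n) :
    X.dnrm m x T ≤ X.nrm T + 2 * δ * (M * X.nrm (deriv T)) := by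
  have hTm := mem_of_mem_trigPoly (X := X) hT
  have hT'm := mem_of_mem_trigPoly (X := X) (deriv_mem_trigPoly hT)
  refine dnrm_le_of_local hend hlt (hTm.bdd_norm.add (hT'm.bdd_local hM hδ)) (fun y => ?_)
    fun k hk y hy => ?_
  · exact add_nonneg (norm_nonneg _) (intervalIntegral.integral_nonneg (by linarith)
      fun _ _ => norm_nonneg _)
  · have := hgap k hk
    have e : T (x k) = T y - ∫ t in (x k)..y, deriv T t := by
      rw [integral_deriv_of_mem_trigPoly hT]; ring
    rw [e]
    exact norm_sub_le_of_le le_rfl (norm_integral_le_of_subset hT'm.intervalIntegrable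
      (by linarith [hy.2]) hy.1 (by linarith))

/-- Replacing `g` by `g - A_h g` changes the samples by those of an average, at a cost of `C ‖g‖_X`;
repeat `r` times. -/
lemma dnrm_diffPow_compare {h : ℝ} (hh : 0 < h) (r : ℕ) {g : ℝ → ℂ} (hg : X.Mem g) :
    X.dnrm m x g ≤ X.dnrm m x (diffPow (steklov h) r g)
        + (1 + 2 * (δ / h)) * M * r * (1 + M) ^ r * X.nrm g ∧
      X.dnrm m x (diffPow (steklov h) r g) ≤ X.dnrm m x g
        + (1 + 2 * (δ / h)) * M * r * (1 + M) ^ r * X.nrm g := by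
  induction r generalizing g with
  | zero => simp [diffPow_zero]
  | succ r ih =>
    obtain ⟨hA, hA'⟩ := mem_steklov hM hg hh
    have hD := dnrm_steklov_le hM hend hlt hgap hδ hg hh
    obtain ⟨i1, i2⟩ := ih (hg.sub hA)
    rw [diffPow_succ]
    set c := (1 + 2 * (δ / h)) * M with hc
    have hc0 : 0 ≤ c := by positivity
    have t1 := dnrm_le_add_sub (X := X) m x g (g - steklov h g)
    rw [sub_sub_cancel] at t1
    have t2 := dnrm_sub_le (X := X) m x g (steklov h g)
    have n1 : X.nrm (g - steklov h g) ≤ (1 + M) * X.nrm g :=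
      (nrm_sub_le hg hA).trans (by linarith)
    have key : c * r * (1 + M) ^ r * X.nrm (g - steklov h g) + c * X.nrm g
        ≤ c * (r + 1 : ℕ) * (1 + M) ^ (r + 1) * X.nrm g := by
      have hp : (1 : ℝ) ≤ (1 + M) ^ (r + 1) := one_le_pow₀ (by simp)
      have hg0 := nrm_nonneg (X := X) g
      calc _ ≤ c * r * (1 + M) ^ r * ((1 + M) * X.nrm g) + c * (1 + M) ^ (r + 1) * X.nrm g := by
            gcongr
            nlinarith
        _ = _ := by push_cast; ring
    exact ⟨by linarith, by linarith⟩

end Nodes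

/-! ### Boas, Bernstein and Jackson inequalities of order `s` -/

variable {γ : ℝ} (hγ : 0 < γ) {n : ℕ} (hn : 1 ≤ n)
include hγ hn

/-- A Boas-type inequality for trigonometric polynomials. -/
lemma nrm_iteratedDeriv_le (s : ℕ) {T : ℝ → ℂ} (hT : T ∈ trigPoly n) :
    (1 / n : ℝ) ^ s * X.nrm (iteratedDeriv s T)
      ≤ (64 * kernelSize γ * (481 * M + 1)) ^ s * X.nrm (diffPow (steklovDot (γ / n)) s T) := by
  have := kernelSize_pos hγ
  have hmul := isFourierMultiplier_steklovDot (γ / n)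
  induction s generalizing T with
  | zero => simp [diffPow_zero]
  | succ s ih =>
    have h1 := ih (deriv_mem_trigPoly hT)
    rw [← (hmul.diffPow s).deriv_apply hT] at h1
    have h2 := nrm_deriv_le hM hγ hn ((hmul.diffPow s).mem_trigPoly hT)
    rw [← diffPow_succ'] at h2
    rw [iteratedDeriv_succ']
    set κ := 64 * kernelSize γ * (481 * M + 1)
    calc _ = (1 / n : ℝ) * ((1 / n : ℝ) ^ s * X.nrm (iteratedDeriv s (deriv T))) := by ring
      _ ≤ (1 / n : ℝ) * (κ ^ s * X.nrm (deriv (diffPow (steklovDot (γ / n)) s T))) := by gcongr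
      _ = κ ^ s * ((1 / n : ℝ) * X.nrm (deriv (diffPow (steklovDot (γ / n)) s T))) := by ring
      _ ≤ κ ^ s * (κ * X.nrm (diffPow (steklovDot (γ / n)) (s + 1) T)) := by gcongr
      _ = _ := by ring

/-- The Bernstein inequality. -/
lemma nrm_iteratedDeriv_bernstein (s : ℕ) {T : ℝ → ℂ} (hT : T ∈ trigPoly n) :
    (1 / n : ℝ) ^ s * X.nrm (iteratedDeriv s T)
      ≤ (64 * kernelSize γ * (481 * M + 1) * (1 + 2 * M)) ^ s * X.nrm T := by
  have hk := kernelSize_pos hγ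
  have hh : 0 < γ / n := div_pos hγ (by exact_mod_cast hn)
  refine (nrm_iteratedDeriv_le hM hγ hn s hT).trans ?_
  rw [mul_pow _ (1 + 2 * (M : ℝ)), mul_assoc ((64 * kernelSize γ * (481 * M + 1)) ^ s)]
  exact mul_le_mul_of_nonneg_left (mem_diffPow (fun f hf => mem_steklovDot hM hf hh)
    (by positivity) s (mem_of_mem_trigPoly hT)).2 (by positivity)

/-- A Jackson-type approximation theorem. -/
lemma exists_trigPoly_nrm_sub_le (s : ℕ) {f : ℝ → ℂ} (hf : X.Mem f) :
    ∃ T ∈ trigPoly n, X.nrm (f - T)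
      ≤ (64 * kernelSize γ * (481 * M + 1)) ^ s * X.nrm (diffPow (steklovDot (γ / n)) s f) := by
  have hk := kernelSize_pos hγ
  have hh : 0 < γ / n := div_pos hγ (by exact_mod_cast hn)
  set J := jackson (n / 3) 0 with hJ
  have hJc : Continuous J := continuous_of_mem_trigPoly (jackson_mem_trigPoly _ _)
  set κ := 64 * kernelSize γ * (481 * M + 1) with hκ
  set A := steklovDot (γ / n) with hA
  have hV : ∀ g, X.Mem g → circleConv J g ∈ trigPoly n := fun g hg =>
    trigPoly_mono (by omega)
      (circleConv_mem_trigPoly (jackson_mem_trigPoly (n / 3) 0) hg.intervalIntegrable hg.per)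
  have hAm : ∀ f, X.Mem f → X.Mem (A f) ∧ X.nrm (A f) ≤ 2 * M * X.nrm f :=
    fun f hf => mem_steklovDot hM hf hh
  have hAsub : ∀ f g, X.Mem f → X.Mem g → A (f - g) = A f - A g := fun f g hf hg =>
    steklovDot_sub hf.intervalIntegrable hg.intervalIntegrable _
  have hcomm : ∀ s g, X.Mem g → diffPow A s (circleConv J g) = circleConv J (diffPow A s g) := by
    intro s g hg
    induction s with
    | zero => rfl
    | succ s ih =>
      have h1 := (mem_diffPow hAm (by positivity) s hg).1
      rw [diffPow_succ', diffPow_succ', ih, circleConv_sub hJc h1.intervalIntegrable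
        (hAm _ h1).1.intervalIntegrable, hA, circleConv_steklovDot hJc h1.intervalIntegrable hh]
  -- Each factor `I - V`, with `V` convolution by `J`, is exchanged for `κ` times a factor `I -
  -- Ȧ_h`; commutation lets the first-order estimate act on `(I - Ȧ_h)^s g`.
  have hbound : ∀ s g, X.Mem g → X.nrm (diffPow (circleConv J) s g)
      ≤ κ ^ s * X.nrm (diffPow A s g) := by
    intro s
    induction s with
    | zero => intro g _; simp [diffPow_zero]
    | succ s ih =>
      intro g hg
      have hVg := mem_of_mem_trigPoly (X := X) (hV g hg)
      have h1 := ih _ (hg.sub hVg)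
      have hD := (mem_diffPow hAm (by positivity) s hg).1
      rw [diffPow_sub hAm hAsub s hg hVg, hcomm s g hg] at h1
      have h2 := nrm_sub_circleConv_le hM hγ hn hD
      rw [← hA, ← diffPow_succ'] at h2
      calc _ ≤ _ := h1
        _ ≤ κ ^ s * (κ * X.nrm (diffPow A (s + 1) g)) := by gcongr
        _ = _ := by ring
  -- `I - (I - V)^s` is a polynomial in `V` without constant term, so its range stays in `𝒯_n`; the
  -- approximant is its value at `f`.
  have htrig : ∀ s g, X.Mem g → g - diffPow (circleConv J) s g ∈ trigPoly n := by
    intro s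
    induction s with
    | zero =>
      intro g _
      rw [diffPow_zero, sub_self]
      exact (trigPolySubmodule n).zero_mem
    | succ s ih =>
      intro g hg
      have hVg := hV g hg
      have h1 := ih _ (hg.sub (mem_of_mem_trigPoly (X := X) hVg))
      have := (trigPolySubmodule n).add_mem hVg h1
      rw [diffPow_succ]
      have e : g - diffPow (circleConv J) s (g - circleConv J g) = circleConv J g
          + (g - circleConv J g - diffPow (circleConv J) s (g - circleConv J g)) := by abel
      rw [e]
      exact this
  refine ⟨_, htrig s f hf, ?_⟩
  rw [sub_sub_cancel]
  exact hbound s f hf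

end PeriodicBanachLattice

/-! ### Comparison of the moduli with the realization -/

lemma sampling_sub (m : ℕ) (x : ℕ → ℝ) (φ : ℕ → ℝ → ℂ) (f g : ℝ → ℂ) :
    sampling m x φ (f - g) = sampling m x φ f - sampling m x φ g := by
  ext y
  simp only [sampling, Pi.sub_apply, sub_mul, Finset.sum_sub_distrib]

namespace PeriodicBanachLattice

variable {X : PeriodicBanachLattice} {M : ℝ≥0}
  (hM : ∀ h : ℝ, 0 < h → ∀ f, X.Mem f → X.norm (steklov h f) ≤ M * X.norm f)
include hM

/-- Discrete norms of `(I - A_h)^r T` are controlled by the `s`-th derivative, `s ≤ 2r`. -/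
lemma exists_dnrm_diffPow_trigPoly_le {γ γ' : ℝ} (hγ : 0 < γ) (hγ' : 0 < γ') {m : ℕ → ℕ}
    {x : ℕ → ℕ → ℝ} (hx : IsNodeSystem γ γ' m x) {r s : ℕ} (hrs : s ≤ 2 * r) :
    ∃ C : ℝ, 0 ≤ C ∧ ∀ n : ℕ, 1 ≤ n → ∀ T ∈ trigPoly n,
      X.dnrm (m n) (x n) (diffPow (steklov (γ / n)) r T)
        ≤ C * ((1 / n : ℝ) ^ s * X.nrm (iteratedDeriv s T)) := by
  have hk := kernelSize_pos hγ
  set b := 64 * kernelSize γ * (481 * M + 1) * (1 + 2 * M) with hb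
  have hb0 : 0 ≤ b := by positivity
  refine ⟨(1 + 2 * γ' * M * b) * ((γ ^ 2 / 2 * M) ^ r * b ^ (2 * r - s)), by positivity,
    fun n hn T hT => ?_⟩
  have hn0 : (0 : ℝ) < n := by exact_mod_cast hn
  have hh : 0 < γ / n := div_pos hγ hn0
  obtain ⟨hend, hgap⟩ := hx n hn
  have hmul := isFourierMultiplier_steklov (γ / n)
  set P := diffPow (steklov (γ / n)) r T with hP
  have hPt : P ∈ trigPoly n := (hmul.diffPow r).mem_trigPoly hT
  have h1 := dnrm_trigPoly_le hM hend (δ := γ' / n) (fun k hk => by linarith [(hgap k hk).1])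
    (fun k hk => (hgap k hk).2) (by positivity) hPt
  have h2 := nrm_iteratedDeriv_bernstein (X := X) hM hγ hn 1 hPt
  rw [pow_one, pow_one, iteratedDeriv_one] at h2
  have h3 : X.dnrm (m n) (x n) P ≤ (1 + 2 * γ' * M * b) * X.nrm P := by
    calc _ ≤ _ := h1
      _ = X.nrm P + 2 * γ' * M * ((1 / n : ℝ) * X.nrm (deriv P)) := by ring
      _ ≤ X.nrm P + 2 * γ' * M * (b * X.nrm P) := by gcongr
      _ = _ := by ring
  have h4 := nrm_diffPow_le_iteratedDeriv (X := X) hmul (n := n) (p := 2)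
    (c := (γ / n) ^ 2 / 2 * M) (by positivity) (fun T hT => nrm_sub_steklov_le hM hT hh) r hT
  -- The `2r - s` derivatives in excess of `s` are paid for by Bernstein's inequality applied to
  -- `T^{(s)}`.
  have h5 := nrm_iteratedDeriv_bernstein (X := X) hM hγ hn (2 * r - s)
    (iteratedDeriv_mem_trigPoly hT s)
  have e5 : iteratedDeriv (2 * r - s) (iteratedDeriv s T) = iteratedDeriv (2 * r) T := by
    simp only [iteratedDeriv_eq_iterate, ← Function.iterate_add_apply]
    congr 2; omega
  rw [e5] at h5
  have e6 : ((γ / n) ^ 2 / 2 * M) ^ r = (γ ^ 2 / 2 * M) ^ r * (1 / n : ℝ) ^ (2 * r) := by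
    rw [pow_mul, ← mul_pow]; congr 1; field_simp
  have e7 : (1 / n : ℝ) ^ (2 * r) = (1 / n : ℝ) ^ s * (1 / n : ℝ) ^ (2 * r - s) := by
    rw [← pow_add]; congr 1; omega
  have h6 : X.nrm P ≤ (γ ^ 2 / 2 * M) ^ r * b ^ (2 * r - s) *
      ((1 / n : ℝ) ^ s * X.nrm (iteratedDeriv s T)) := by
    calc _ ≤ _ := h4
      _ = (γ ^ 2 / 2 * M) ^ r * (1 / n : ℝ) ^ s *
          ((1 / n : ℝ) ^ (2 * r - s) * X.nrm (iteratedDeriv (2 * r) T)) := by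
        rw [e6, e7]; ring
      _ ≤ (γ ^ 2 / 2 * M) ^ r * (1 / n : ℝ) ^ s *
          (b ^ (2 * r - s) * X.nrm (iteratedDeriv s T)) := by gcongr
      _ = _ := by ring
  calc _ ≤ _ := h3
    _ ≤ (1 + 2 * γ' * M * b) * ((γ ^ 2 / 2 * M) ^ r * b ^ (2 * r - s) *
      ((1 / n : ℝ) ^ s * X.nrm (iteratedDeriv s T))) := by gcongr
    _ = _ := by ring

/-- `(I - Ȧ_h)^s` is bounded on `X`, uniformly in `h`. -/
lemma nrm_diffPow_steklovDot_le_add {h : ℝ} (hh : 0 < h) (s : ℕ) {u v : ℝ → ℂ} (hu : X.Mem u)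
    (hv : X.Mem v) : X.nrm (diffPow (steklovDot h) s u)
      ≤ X.nrm (diffPow (steklovDot h) s v) + (1 + 2 * M) ^ s * X.nrm (u - v) := by
  have hB : ∀ f, X.Mem f → X.Mem (steklovDot h f) ∧ X.nrm (steklovDot h f) ≤ 2 * M * X.nrm f :=
    fun f hf => mem_steklovDot hM hf hh
  have h1 := diffPow_sub hB (fun f g hf hg => steklovDot_sub hf.intervalIntegrable
    hg.intervalIntegrable _) s hu hv
  have h2 := mem_diffPow hB (by positivity) s (hu.sub hv)
  have h3 : diffPow (steklovDot h) s u
      = diffPow (steklovDot h) s v + diffPow (steklovDot h) s (u - v) := by rw [h1]; abel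
  rw [h3]
  exact (nrm_add_le (mem_diffPow hB (by positivity) s hv).1 h2.1).trans (add_le_add le_rfl h2.2)

lemma diffPow_steklov_sub {h : ℝ} (hh : 0 < h) (r : ℕ) {u v : ℝ → ℂ} (hu : X.Mem u)
    (hv : X.Mem v) :
    diffPow (steklov h) r (u - v) = diffPow (steklov h) r u - diffPow (steklov h) r v :=
  diffPow_sub (fun _ hf => mem_steklov hM hf hh) (fun _ _ hf hg =>
    steklov_sub hf.intervalIntegrable hg.intervalIntegrable _) r hu hv

section Realization

variable {γ γ' : ℝ} (hγ : 0 < γ) (hγ' : 0 < γ') {m : ℕ → ℕ} {x : ℕ → ℕ → ℝ}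
  (hx : IsNodeSystem γ γ' m x)
include hγ hγ' hx

lemma exists_dnrm_diffPow_compare (r : ℕ) : ∃ C : ℝ, 0 ≤ C ∧ ∀ n : ℕ, 1 ≤ n → ∀ g, X.Mem g →
    X.dnrm (m n) (x n) g
        ≤ X.dnrm (m n) (x n) (diffPow (steklov (γ / n)) r g) + C * X.nrm g ∧
      X.dnrm (m n) (x n) (diffPow (steklov (γ / n)) r g)
        ≤ X.dnrm (m n) (x n) g + C * X.nrm g := by
  refine ⟨(1 + 2 * (γ' / γ)) * M * r * (1 + M) ^ r, by positivity, fun n hn g hg => ?_⟩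
  have hn0 : (0 : ℝ) < n := by exact_mod_cast hn
  have hh : 0 < γ / n := div_pos hγ hn0
  obtain ⟨hend, hgap⟩ := hx n hn
  have := dnrm_diffPow_compare hM hend (δ := γ' / n) (fun k hk => by linarith [(hgap k hk).1])
    (fun k hk => (hgap k hk).2) (by positivity) hh r hg
  rwa [show γ' / n / (γ / n) = γ' / γ by field_simp] at this

/-- The moduli of `f` are controlled by the approximation with a trigonometric polynomial. -/
lemma exists_modulus_le {r s : ℕ} (hrs : s ≤ 2 * r) : ∃ C : ℝ, 0 < C ∧ ∀ n : ℕ, 1 ≤ n →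
    ∀ f, X.Mem f → ∀ T ∈ trigPoly n,
      X.dnrm (m n) (x n) (diffPow (steklov (γ / n)) r f)
          + X.nrm (diffPow (steklovDot (γ / n)) s f)
        ≤ C * (X.nrm (f - T) + X.dnrm (m n) (x n) (f - T)
          + (1 / n : ℝ) ^ s * X.nrm (iteratedDeriv s T)) := by
  obtain ⟨C₁, hC₁, hcmp⟩ := exists_dnrm_diffPow_compare (X := X) hM hγ hγ' hx r
  obtain ⟨C₂, hC₂, hdisc⟩ := exists_dnrm_diffPow_trigPoly_le (X := X) hM hγ hγ' hx hrs
  refine ⟨1 + (1 + 2 * M) ^ s + C₁ + (2 * γ * M) ^ s + C₂, by positivity,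
    fun n hn f hf T hT => ?_⟩
  have hh : 0 < γ / n := div_pos hγ (by exact_mod_cast hn)
  have hTm := mem_of_mem_trigPoly (X := X) hT
  have h1 := nrm_diffPow_steklovDot_le_add hM hh s hf hTm
  have h2 := nrm_diffPow_le_iteratedDeriv (X := X) (isFourierMultiplier_steklovDot (γ / n))
    (n := n) (p := 1) (c := 2 * (γ / n) * M) (by positivity)
    (fun T hT => nrm_sub_steklovDot_le hM hT hh) s hT
  rw [one_mul, show 2 * (γ / n) * M = 2 * γ * M * (1 / n : ℝ) by ring, mul_pow, mul_assoc] at h2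
  have h3 := dnrm_le_add_sub (X := X) (m n) (x n) (diffPow (steklov (γ / n)) r f)
    (diffPow (steklov (γ / n)) r T)
  rw [← diffPow_steklov_sub hM hh r hf hTm] at h3
  have h4 := hdisc n hn T hT
  have h5 := (hcmp n hn _ (hf.sub hTm)).2
  have ha₁ := nrm_nonneg (X := X) (f - T)
  have ha₂ := dnrm_nonneg (X := X) (m n) (x n) (f - T)
  have ha₃ : 0 ≤ (1 / n : ℝ) ^ s * X.nrm (iteratedDeriv s T) :=
    mul_nonneg (by positivity) (nrm_nonneg _)
  generalize X.nrm (f - T) = a₁ at *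
  generalize X.dnrm (m n) (x n) (f - T) = a₂ at *
  generalize (1 / n : ℝ) ^ s * X.nrm (iteratedDeriv s T) = a₃ at *
  have hP : 0 ≤ (1 + 2 * (M : ℝ)) ^ s := by positivity
  have hQ : 0 ≤ (2 * γ * M) ^ s := by positivity
  generalize (1 + 2 * (M : ℝ)) ^ s = P at *
  generalize (2 * γ * M) ^ s = Q at *
  calc _ ≤ (C₁ + P) * a₁ + 1 * a₂ + (C₂ + Q) * a₃ := by linarith
    _ ≤ (1 + P + C₁ + Q + C₂) * a₁ + (1 + P + C₁ + Q + C₂) * a₂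
        + (1 + P + C₁ + Q + C₂) * a₃ :=
      add_le_add (add_le_add (mul_le_mul_of_nonneg_right (by linarith) ha₁)
        (mul_le_mul_of_nonneg_right (by linarith) ha₂))
        (mul_le_mul_of_nonneg_right (by linarith) ha₃)
    _ = _ := by ring

/-- The realization attached to stable sampling operators is controlled by the moduli of `f`. -/
lemma exists_realization_le {r s : ℕ} (hrs : s ≤ 2 * r) {φ : ℕ → ℕ → ℝ → ℂ}
    (hG : ∀ n : ℕ, 1 ≤ n → ∀ f, X.Mem f → sampling (m n) (x n) (φ n) f ∈ trigPoly n)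
    {K₁ K₃ : ℝ} (hK₁ : 0 ≤ K₁) (hK₃ : 0 ≤ K₃)
    (hA1 : ∀ n : ℕ, 1 ≤ n → ∀ g, X.Mem g →
      X.nrm (sampling (m n) (x n) (φ n) g) ≤ K₁ * X.dnrm (m n) (x n) g)
    (hA3 : ∀ n : ℕ, 1 ≤ n → ∀ T ∈ trigPoly n, X.nrm (T - sampling (m n) (x n) (φ n) T)
      ≤ K₃ * ((1 / n : ℝ) ^ s * X.nrm (iteratedDeriv s T))) :
    ∃ C : ℝ, 0 < C ∧ ∀ n : ℕ, 1 ≤ n → ∀ f, X.Mem f →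
      X.nrm (f - sampling (m n) (x n) (φ n) f)
          + X.dnrm (m n) (x n) (f - sampling (m n) (x n) (φ n) f)
          + (1 / n : ℝ) ^ s * X.nrm (iteratedDeriv s (sampling (m n) (x n) (φ n) f))
        ≤ C * (X.dnrm (m n) (x n) (diffPow (steklov (γ / n)) r f)
          + X.nrm (diffPow (steklovDot (γ / n)) s f)) := by
  obtain ⟨C₁, hC₁, hcmp⟩ := exists_dnrm_diffPow_compare (X := X) hM hγ hγ' hx r
  obtain ⟨C₂, hC₂, hdisc⟩ := exists_dnrm_diffPow_trigPoly_le (X := X) hM hγ hγ' hx hrs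
  obtain ⟨κ, hκ⟩ : ∃ κ, κ = (64 * kernelSize γ * (481 * M + 1)) ^ s := ⟨_, rfl⟩
  have hκ0 : 0 ≤ κ := by
    have := kernelSize_pos hγ
    rw [hκ]; positivity
  obtain ⟨P, hP⟩ : ∃ P, P = (1 + 2 * (M : ℝ)) ^ s := ⟨_, rfl⟩
  have hP0 : 0 ≤ P := by rw [hP]; positivity
  -- With `E` and `W` the discrete and continuous moduli of `f`, the constants serve these bounds:
  -- `q₂` for `n^{-s} ‖T^{(s)}‖`, `q₃` for `‖f - T‖_{X_n}`, `q₄` for `‖f - G f‖_X`, `q₅` for `n^{-s}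
  -- ‖(G f)^{(s)}‖`.
  obtain ⟨q₂, hq₂⟩ : ∃ q, q = κ * (1 + P * κ) := ⟨_, rfl⟩
  have hq₂0 : 0 ≤ q₂ := by rw [hq₂]; positivity
  obtain ⟨q₃, hq₃⟩ : ∃ q, q = C₂ * q₂ + C₁ * κ := ⟨_, rfl⟩
  have hq₃0 : 0 ≤ q₃ := by rw [hq₃]; positivity
  obtain ⟨q₄, hq₄⟩ : ∃ q, q = κ + K₃ * q₂ + K₁ * (1 + q₃) := ⟨_, rfl⟩
  have hq₄0 : 0 ≤ q₄ := by rw [hq₄]; positivity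
  obtain ⟨q₅, hq₅⟩ : ∃ q, q = κ * (1 + P * q₄) := ⟨_, rfl⟩
  have hq₅0 : 0 ≤ q₅ := by rw [hq₅]; positivity
  refine ⟨1 + q₄ + (1 + C₂ * q₅ + C₁ * q₄) + q₅, by positivity, fun n hn f hf => ?_⟩
  have hh : 0 < γ / n := div_pos hγ (by exact_mod_cast hn)
  have hboas : ∀ T ∈ trigPoly n, (1 / n : ℝ) ^ s * X.nrm (iteratedDeriv s T)
      ≤ κ * X.nrm (diffPow (steklovDot (γ / n)) s T) := fun T hT => by
    rw [hκ]; exact nrm_iteratedDeriv_le hM hγ hn s hT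
  have hAsub : ∀ u v, X.Mem u → X.Mem v →
      X.dnrm (m n) (x n) (diffPow (steklov (γ / n)) r (u - v))
        ≤ X.dnrm (m n) (x n) (diffPow (steklov (γ / n)) r u)
          + X.dnrm (m n) (x n) (diffPow (steklov (γ / n)) r v) := fun u v hu hv => by
    rw [diffPow_steklov_sub hM hh r hu hv]
    exact dnrm_sub_le _ _ _ _
  have hBadd : ∀ u v, X.Mem u → X.Mem v → X.nrm (diffPow (steklovDot (γ / n)) s u)
      ≤ X.nrm (diffPow (steklovDot (γ / n)) s v) + P * X.nrm (v - u) := fun u v hu hv => by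
    rw [hP, nrm_sub_comm]; exact nrm_diffPow_steklovDot_le_add hM hh s hu hv
  obtain ⟨T, hT, hfT⟩ := exists_trigPoly_nrm_sub_le hM hγ hn s hf
  rw [← hκ] at hfT
  have hGf := hG n hn f hf
  have hA1n := hA1 n hn
  have hA3n := hA3 n hn T hT
  have hTm := mem_of_mem_trigPoly (X := X) hT
  have hGfm := mem_of_mem_trigPoly (X := X) hGf
  have hfTm := hf.sub hTm
  have hGT := mem_of_mem_trigPoly (X := X) (hG n hn T hTm)
  have hGfT := mem_of_mem_trigPoly (X := X) (hG n hn (f - T) hfTm)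
  have hlin := sampling_sub (m n) (x n) (φ n) f T
  generalize sampling (m n) (x n) (φ n) = G at *
  have hW0 : 0 ≤ X.nrm (diffPow (steklovDot (γ / n)) s f) := nrm_nonneg _
  have hE0 : 0 ≤ X.dnrm (m n) (x n) (diffPow (steklov (γ / n)) r f) := dnrm_nonneg _ _ _
  have b1 := hBadd T f hTm hf
  have b2 := hBadd (G f) f hGfm hf
  have b3 := hAsub f T hf hTm
  have b4 := hAsub f (G f) hf hGfm
  generalize X.nrm (diffPow (steklovDot (γ / n)) s f) = W at *
  generalize X.dnrm (m n) (x n) (diffPow (steklov (γ / n)) r f) = E at *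
  have h2 : (1 / n : ℝ) ^ s * X.nrm (iteratedDeriv s T) ≤ q₂ * W := by
    calc _ ≤ κ * X.nrm (diffPow (steklovDot (γ / n)) s T) := hboas T hT
      _ ≤ κ * (W + P * (κ * W)) :=
        mul_le_mul_of_nonneg_left (b1.trans (by gcongr)) hκ0
      _ = q₂ * W := by rw [hq₂]; ring
  -- `T` approximates `f` only in `X`, with no direct control at the nodes. Its samples are reached
  -- through `(I - A_h)^r (f - T)`, whose two parts are `E` and a polynomial term.
  have h3 : X.dnrm (m n) (x n) (f - T) ≤ E + q₃ * W := by
    calc _ ≤ _ := (hcmp n hn _ hfTm).1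
      _ ≤ (E + C₂ * (q₂ * W)) + C₁ * (κ * W) := by
        refine add_le_add (b3.trans (add_le_add le_rfl ?_))
          (mul_le_mul_of_nonneg_left hfT hC₁)
        exact (hdisc n hn T hT).trans (mul_le_mul_of_nonneg_left h2 hC₂)
      _ = _ := by rw [hq₃]; ring
  have h4 : X.nrm (f - G f) ≤ q₄ * (E + W) := by
    have e : f - G f = (f - T) + ((T - G T) - G (f - T)) := by rw [hlin]; abel
    calc X.nrm (f - G f) ≤ κ * W + (K₃ * (q₂ * W) + K₁ * (E + q₃ * W)) := by
          rw [e]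
          refine (nrm_add_le hfTm ((hTm.sub hGT).sub hGfT)).trans (add_le_add hfT ?_)
          refine (nrm_sub_le (hTm.sub hGT) hGfT).trans (add_le_add ?_ ?_)
          · exact hA3n.trans (mul_le_mul_of_nonneg_left h2 hK₃)
          · exact (hA1n _ hfTm).trans (mul_le_mul_of_nonneg_left h3 hK₁)
      _ ≤ κ * (E + W) + (K₃ * (q₂ * (E + W)) + K₁ * ((E + W) + q₃ * (E + W))) := by
        gcongr <;> linarith
      _ = _ := by rw [hq₄]; ring
  -- The Boas-type inequality for `G f`; its modulus differs from that of `f` by at most `P ‖f - G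
  -- f‖_X`, already bounded.
  have h5 : (1 / n : ℝ) ^ s * X.nrm (iteratedDeriv s (G f)) ≤ q₅ * (E + W) := by
    calc _ ≤ κ * X.nrm (diffPow (steklovDot (γ / n)) s (G f)) := hboas _ hGf
      _ ≤ κ * ((E + W) + P * (q₄ * (E + W))) :=
        mul_le_mul_of_nonneg_left (b2.trans (add_le_add (by linarith)
          (mul_le_mul_of_nonneg_left h4 hP0))) hκ0
      _ = _ := by rw [hq₅]; ring
  have h6 : X.dnrm (m n) (x n) (f - G f) ≤ (1 + C₂ * q₅ + C₁ * q₄) * (E + W) := by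
    calc _ ≤ _ := (hcmp n hn _ (hf.sub hGfm)).1
      _ ≤ (E + C₂ * (q₅ * (E + W))) + C₁ * (q₄ * (E + W)) := by
        refine add_le_add (b4.trans (add_le_add le_rfl ?_)) (mul_le_mul_of_nonneg_left h4 hC₁)
        exact (hdisc n hn _ hGf).trans (mul_le_mul_of_nonneg_left h5 hC₂)
      _ ≤ (E + W) + C₂ * (q₅ * (E + W)) + C₁ * (q₄ * (E + W)) := by linarith
      _ = _ := by ring
  calc _ ≤ q₄ * (E + W) + (1 + C₂ * q₅ + C₁ * q₄) * (E + W) + q₅ * (E + W) :=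
        add_le_add (add_le_add h4 h6) h5
    _ ≤ (E + W) + (q₄ * (E + W) + (1 + C₂ * q₅ + C₁ * q₄) * (E + W) + q₅ * (E + W)) := by
        linarith
    _ = _ := by ring

end Realization

end PeriodicBanachLattice

/-! ### The main theorem -/

open PeriodicBanachLattice in
theorem theorem3p5 (X : PeriodicBanachLattice) (hX : AssumptionA X)
    (r s : ℕ) (hr : 1 ≤ r) (hs : 1 ≤ s) (hrs : s ≤ 2 * r)
    (γ γ' : ℝ) (hγ : 0 < γ) (hγ' : 0 < γ')
    (m : ℕ → ℕ) (x : ℕ → ℕ → ℝ) (hx : IsNodeSystem γ γ' m x)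
    (φ : ℕ → ℕ → ℝ → ℂ)
    (hG : ∀ n : ℕ, 1 ≤ n → ∀ f, X.Mem f → sampling (m n) (x n) (φ n) f ∈ trigPoly n)
    (hA1 : ConditionA1 X m x φ) (hA3 : ConditionA3 X s m x φ) :
    ∃ c C : ℝ≥0, 0 < c ∧ 0 < C ∧ ∀ n : ℕ, 1 ≤ n → ∀ f, X.Mem f →
      realization X s (m n) (x n) (φ n) f (1 / n) < ∞ ∧
      c * (discreteNorm X (m n) (x n) (diffPow (steklov (γ / n)) r f)
            + X.norm (diffPow (steklovDot (γ / n)) s f))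
        ≤ realization X s (m n) (x n) (φ n) f (1 / n) ∧
      realization X s (m n) (x n) (φ n) f (1 / n)
        ≤ C * (discreteNorm X (m n) (x n) (diffPow (steklov (γ / n)) r f)
            + X.norm (diffPow (steklovDot (γ / n)) s f)) := by
  obtain ⟨M, hM⟩ := hX
  obtain ⟨K₁, -, hK₁⟩ := hA1
  obtain ⟨K₃, -, hK₃⟩ := hA3
  have hA1' : ∀ n : ℕ, 1 ≤ n → ∀ g, X.Mem g →
      X.nrm (sampling (m n) (x n) (φ n) g) ≤ K₁ * X.dnrm (m n) (x n) g := by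
    intro n hn g hg
    have h1 := hK₁ n hn g hg
    rw [discreteNorm_eq_ofReal] at h1
    have h2 := ENNReal.toReal_mono (ENNReal.mul_ne_top (by simp) (by simp)) h1
    rwa [ENNReal.toReal_mul, ENNReal.toReal_ofReal (dnrm_nonneg _ _ _)] at h2
  have hA3' : ∀ n : ℕ, 1 ≤ n → ∀ T ∈ trigPoly n, X.nrm (T - sampling (m n) (x n) (φ n) T)
      ≤ K₃ * ((1 / n : ℝ) ^ s * X.nrm (iteratedDeriv s T)) := by
    intro n hn T hT
    have h1 := hK₃ n hn T hT
    have hTm := mem_of_mem_trigPoly (X := X) (iteratedDeriv_mem_trigPoly hT s)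
    have h2 := ENNReal.toReal_mono (ENNReal.mul_ne_top
      (ENNReal.mul_ne_top (by simp) (by simp)) hTm.ne) h1
    rw [ENNReal.toReal_mul, ENNReal.toReal_mul, ENNReal.toReal_ofReal (by positivity),
      mul_assoc] at h2
    exact h2
  obtain ⟨C₁, hC₁, hlower⟩ := exists_modulus_le (X := X) hM hγ hγ' hx hrs
  obtain ⟨C₂, hC₂, hupper⟩ := exists_realization_le hM hγ hγ' hx hrs hG K₁.2 K₃.2 hA1' hA3'
  refine ⟨(C₁⁻¹).toNNReal, C₂.toNNReal, by simpa using hC₁, by simpa using hC₂,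
    fun n hn f hf => ?_⟩
  have hh : 0 < γ / n := div_pos hγ (by exact_mod_cast hn)
  have hGf := hG n hn f hf
  -- The lower estimate is the general comparison with the polynomial taken to be `G_n f`.
  have hlow := hlower n hn f hf _ hGf
  have hup := hupper n hn f hf
  have hfG := hf.sub (mem_of_mem_trigPoly (X := X) hGf)
  have hDm := mem_of_mem_trigPoly (X := X) (iteratedDeriv_mem_trigPoly hGf s)
  have hBf := (mem_diffPow (fun f hf => mem_steklovDot hM hf hh) (by positivity) s hf).1
  have hreal : realization X s (m n) (x n) (φ n) f (1 / n)
      = ENNReal.ofReal (X.nrm (f - sampling (m n) (x n) (φ n) f)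
          + X.dnrm (m n) (x n) (f - sampling (m n) (x n) (φ n) f)
          + (1 / n : ℝ) ^ s * X.nrm (iteratedDeriv s (sampling (m n) (x n) (φ n) f))) := by
    rw [realization, discreteNorm_eq_ofReal, hfG.norm_eq, hDm.norm_eq,
      ← ENNReal.ofReal_mul (by positivity), ← ENNReal.ofReal_add (nrm_nonneg _)
      (dnrm_nonneg _ _ _), ← ENNReal.ofReal_add (add_nonneg (nrm_nonneg _) (dnrm_nonneg _ _ _))
      (mul_nonneg (by positivity) (nrm_nonneg _))]
  have hmod : discreteNorm X (m n) (x n) (diffPow (steklov (γ / n)) r f)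
        + X.norm (diffPow (steklovDot (γ / n)) s f)
      = ENNReal.ofReal (X.dnrm (m n) (x n) (diffPow (steklov (γ / n)) r f)
          + X.nrm (diffPow (steklovDot (γ / n)) s f)) := by
    rw [discreteNorm_eq_ofReal, Mem.norm_eq hBf, ← ENNReal.ofReal_add (dnrm_nonneg _ _ _)
      (nrm_nonneg _)]
  rw [hreal, hmod]
  refine ⟨ENNReal.ofReal_lt_top, ?_, ?_⟩
  · refine (ENNReal.ofReal_mul (by positivity)).symm.le.trans (ENNReal.ofReal_le_ofReal ?_)
    rwa [inv_mul_le_iff₀ hC₁]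
  · exact (ENNReal.ofReal_le_ofReal hup).trans (ENNReal.ofReal_mul hC₂.le).le

end
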